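/- Let $m>1/2$ and $r_\tau>0$, and let $\theta_\tau\in\{\pi,\pi/2\}$. Consider the reduced Bloch system $$\dot a=-\sin^2\theta,\qquad \dot\theta=u-\sin\theta\cos\theta,\qquad |u|\le m,\qquad a=\ln r .$$ A \emph{transfer} to $(r_\tau,\theta_\tau)$ is a measurable control $u$ on a nonempty time interval $I$, together with a (Carathéodory) solution $(a,\theta)$ on $I$, that runs from $(r,\theta)=(1,0)$ to $(r_\tau,\theta_\tau)$. The duration is free and may be infinite; at an infinite end of $I$ the boundary values are taken as limits. Its energy is $\int_I u^2/2\,dt\in[0,\infty]$. A feedback law $U$ is called \emph{minimum-energy} if (i) some transfer of least energy among all transfers (with finite energy) follows $U$, i.e. $\theta(t)\in[0,\theta_\tau]$ on $I$ and $u(t)=U(\theta(t))$ for almost every $t$; (ii) every transfer of least energy follows $U$; (iii) the least energy equals the infimum of the energies of the transfers on compact intervals $[0,\tau]$, $\tau>0$ free. Let $\cot^{-1}$ take values in $(0,\pi)$, put $q=\sqrt{4m^2-1}$ and $$r_{C_1}=e^{-\pi/q},\quad r_{C_2}=\frac{m-1}{m+1},\quad r_{D_1}=\exp\Big[-\frac1q\Big(\pi-\cot^{-1}\frac1q\Big)\Big],$$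 $$r_{D_2}=\frac{\sqrt{m^2+2}}{1+\sqrt{m^2+1}}\exp\Big[-\frac1q\cot^{-1}\frac{m^2-1}{q}\Big],\quad r_{D_3}=\frac{\sqrt{m^2-1}}{m+1}\ (m\ge1).$$ For $\kappa>0$ let $u_\kappa(\theta)=\sin\theta\,(\cos\theta+\sqrt{\cos^2\theta+\kappa^2})$, and let $u_{\kappa,\theta_1,\theta_2}(\theta)=m$ for $\theta\in(\theta_1,\theta_2)$ and $=u_\kappa(\theta)$ otherwise. Put $$R_\kappa(\alpha,\beta)=\frac{\cos\beta+\sqrt{\cos^2\beta+\kappa^2}}{\cos\alpha+\sqrt{\cos^2\alpha+\kappa^2}},$$ $$S(\alpha,\beta)=\sqrt{\frac{2m-\sin2\alpha}{2m-\sin2\beta}}\exp\Big[-\frac1q\Big(\cot^{-1}\frac{2m\cot\beta-1}{q}-\cot^{-1}\frac{2m\cot\alpha-1}{q}\Big)\Big].$$ Call $(\kappa,\theta_1,\theta_2)$ \emph{switching data} if $\kappa>0$, $0<\theta_1<\theta_2<\pi$ and $$\kappa^2=(m\cot\theta_1-1)^2+m^2-1=(1-m\cot\theta_2)^2+m^2-1,\qquad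 \cot\theta_1+\cot\theta_2=\frac2m .$$ Say that there are - \emph{two switchings} if there is exactly one switching data $(\kappa,\theta_1,\theta_2)$ with $\theta_2\le\theta_\tau$ and $r_\tau=R_\kappa(0,\theta_1)\,S(\theta_1,\theta_2)\,R_\kappa(\theta_2,\theta_\tau)$, and $u_{\kappa,\theta_1,\theta_2}$ is the minimum-energy feedback; - \emph{one switching} if there is exactly one switching data with $\theta_1<\theta_\tau<\theta_2$ and $r_\tau=R_\kappa(0,\theta_1)\,S(\theta_1,\theta_\tau)$, and $u_{\kappa,\theta_1,\theta_2}$ is the minimum-energy feedback. Then the following hold. **Reachability.** There is no transfer to $(r_\tau,\pi)$ if $r_\tau>r_{C_1}$, and none to $(r_\tau,\pi/2)$ if $r_\tau>r_{D_1}$. For $(r_{C_1},\pi)$ and for $(r_{D_1},\pi/2)$ the minimum-energy feedback is $u=m$ on $(0,\pi)$ and $u=0$ at $\theta\in\{0,\pi\}$ (limiting switching angles $0$ and $\pi$, $\kappa=\infty$). **Case $m\ge1$, $\theta_\tau=\pi$.** If $r_{C_2}<r_\tau<r_{C_1}$, there are two switchings. If $r_\tau\le r_{C_2}$, there is no switching: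 $u_\kappa$ with $\kappa=2\sqrt{r_\tau}/(1-r_\tau)$ is the minimum-energy feedback. **Case $m\ge1$, $\theta_\tau=\pi/2$.** If $r_{D_2}<r_\tau<r_{D_1}$, there is one switching. If $r_{D_3}<r_\tau\le r_{D_2}$, there are two switchings, with $\theta_2=\pi/2$ exactly when $r_\tau=r_{D_2}$. If $r_\tau\le r_{D_3}$, there is no switching: $u_\kappa$ with $\kappa=2r_\tau/(1-r_\tau^2)$ is the minimum-energy feedback. **Case $1/2<m<1$, $\theta_\tau=\pi$.** If $r_\tau<r_{C_1}$, there are two switchings. **Case $1/2<m<1$, $\theta_\tau=\pi/2$.** If $r_{D_2}<r_\tau<r_{D_1}$, there is one switching. If $r_\tau\le r_{D_2}$, there are two switchings, with $\theta_2=\pi/2$ exactly when $r_\tau=r_{D_2}$. **Switching is unavoidable for $1/2<m<1$.** For neither target and for no real $\kappa$ is the unswitched law $u_\kappa$ (same formula) a minimum-energy feedback. -/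

import Mathlib

open Real Set Filter Topology MeasureTheory

namespace BlochPulse

/-- `IsTransfer m rτ θτ I u a θ`: on the nonempty time interval `I` (bounded or not, with or without
its end points) the control `u`, `|u| ≤ m`, drives the reduced Bloch system
`a' = -sin² θ`, `θ' = u - sin θ cos θ` (Carathéodory solutions, `a = log r`)
from `(r, θ) = (1, 0)` to `(r, θ) = (rτ, θτ)`.

The boundary values are taken along the two ends of `I`. For `I = [0, τ]` the filter `atBot` of `I`
is concentrated at `0` and `atTop` at `τ`, so that these are the conditions
`a 0 = 0`, `θ 0 = 0`, `a τ = log rτ`, `θ τ = θτ`; for an infinite end they are limits. -/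
structure IsTransfer (m rτ θτ : ℝ) (I : Set ℝ) (u a θ : ℝ → ℝ) : Prop where
  interval : I.OrdConnected
  nonempty : I.Nonempty
  measurable_control : AEMeasurable u (volume.restrict I)
  bound : ∀ t ∈ I, |u t| ≤ m
  continuous_angle : ContinuousOn θ I
  angle : ∀ s ∈ I, ∀ t ∈ I, θ t - θ s = ∫ x in s..t, (u x - sin (θ x) * cos (θ x))
  logRadius : ∀ s ∈ I, ∀ t ∈ I, a t - a s = ∫ x in s..t, -(sin (θ x)) ^ 2
  start_logRadius : Tendsto (fun t : I => a t) atBot (𝓝 0)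
  start_angle : Tendsto (fun t : I => θ t) atBot (𝓝 0)
  final_logRadius : Tendsto (fun t : I => a t) atTop (𝓝 (log rτ))
  final_angle : Tendsto (fun t : I => θ t) atTop (𝓝 θτ)

/-- The energy `∫_I u² / 2 dt` of a control, possibly infinite. -/
noncomputable def energy (I : Set ℝ) (u : ℝ → ℝ) : ENNReal :=
  ∫⁻ t in I, ENNReal.ofReal (u t ^ 2 / 2)

/-- A transfer of least (finite) energy among all transfers between the same points, the duration
being free. -/
structure IsMinimumEnergyTransfer (m rτ θτ : ℝ) (I : Set ℝ) (u a θ : ℝ → ℝ) : Prop where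
  transfer : IsTransfer m rτ θτ I u a θ
  finite : energy I u < ⊤
  minimal : ∀ (I' : Set ℝ) (u' a' θ' : ℝ → ℝ),
    IsTransfer m rτ θτ I' u' a' θ' → energy I u ≤ energy I' u'

/-- The angle stays in `[0, θτ]` and the control is given by the feedback law `U`. -/
def Follows (θτ : ℝ) (U : ℝ → ℝ) (I : Set ℝ) (u θ : ℝ → ℝ) : Prop :=
  (∀ t ∈ I, θ t ∈ Icc 0 θτ) ∧ ∀ᵐ t ∂(volume.restrict I), u t = U (θ t)

/-- `U` is the minimum-energy feedback law: there is a minimum-energy transfer that follows `U`,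
every minimum-energy transfer follows `U`, and the minimum energy is also the infimum of the
energies of the transfers on compact time intervals `[0, τ]`, `τ > 0` free. -/
structure IsMinimumEnergyFeedback (m rτ θτ : ℝ) (U : ℝ → ℝ) : Prop where
  exists_minimizer : ∃ (I : Set ℝ) (u a θ : ℝ → ℝ),
    IsMinimumEnergyTransfer m rτ θτ I u a θ ∧ Follows θτ U I u θ
  follows : ∀ (I : Set ℝ) (u a θ : ℝ → ℝ),
    IsMinimumEnergyTransfer m rτ θτ I u a θ → Follows θτ U I u θ
  isGLB_finite_duration : ∀ (I : Set ℝ) (u a θ : ℝ → ℝ),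
    IsMinimumEnergyTransfer m rτ θτ I u a θ →
      IsGLB {E : ENNReal | ∃ (τ : ℝ) (u' a' θ' : ℝ → ℝ), 0 < τ ∧
        IsTransfer m rτ θτ (Icc 0 τ) u' a' θ' ∧ energy (Icc 0 τ) u' = E} (energy I u)

/-- The feedback `sin θ (cos θ + √(cos² θ + κ²))`. -/
noncomputable def regularLaw (κ ϑ : ℝ) : ℝ := sin ϑ * (cos ϑ + √(cos ϑ ^ 2 + κ ^ 2))

/-- The feedback that is `m` between the switching angles and regular outside. -/
noncomputable def switchedLaw (m κ θ₁ θ₂ ϑ : ℝ) : ℝ :=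
  open Classical in if θ₁ < ϑ ∧ ϑ < θ₂ then m else regularLaw κ ϑ

/-- The feedback that is `m` on the whole of `(0, π)`, and `0` at the poles. -/
noncomputable def saturatedLaw (m ϑ : ℝ) : ℝ :=
  open Classical in if 0 < ϑ ∧ ϑ < π then m else 0

/-- The inverse cotangent with values in `(0, π)`. -/
noncomputable def arccot (x : ℝ) : ℝ := π / 2 - arctan x

/-- Factor by which the radius changes between the angles `α` and `β` under the regular law. -/
noncomputable def regularRatio (κ α β : ℝ) : ℝ :=
  (cos β + √(cos β ^ 2 + κ ^ 2)) / (cos α + √(cos α ^ 2 + κ ^ 2))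

/-- Factor by which the radius changes between the angles `α, β ∈ (0, π)` under `u = m`. -/
noncomputable def saturatedRatio (m α β : ℝ) : ℝ :=
  √((2 * m - sin (2 * α)) / (2 * m - sin (2 * β))) *
    exp (-(arccot ((2 * m * cot β - 1) / √(4 * m ^ 2 - 1)) -
      arccot ((2 * m * cot α - 1) / √(4 * m ^ 2 - 1))) / √(4 * m ^ 2 - 1))

/-- Relations between the parameter `κ` and the two switching angles. -/
structure SwitchingAngles (m κ θ₁ θ₂ : ℝ) : Prop where
  kappa_pos : 0 < κ
  first_pos : 0 < θ₁
  first_lt_second : θ₁ < θ₂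
  second_lt_pi : θ₂ < π
  kappa_first : κ ^ 2 = (m * cot θ₁ - 1) ^ 2 + m ^ 2 - 1
  kappa_second : κ ^ 2 = (1 - m * cot θ₂) ^ 2 + m ^ 2 - 1
  cot_add_cot : cot θ₁ + cot θ₂ = 2 / m

/-- Both switchings take place up to `θτ`, and the trajectory with switching angles `θ₁, θ₂` runs
from `(1, 0)` to `(rτ, θτ)`. -/
structure TwoSwitchEquations (m rτ θτ κ θ₁ θ₂ : ℝ) : Prop where
  angles : SwitchingAngles m κ θ₁ θ₂
  second_le : θ₂ ≤ θτ
  radius : rτ = regularRatio κ 0 θ₁ * saturatedRatio m θ₁ θ₂ * regularRatio κ θ₂ θτ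

/-- Only the first switching takes place up to `θτ`, and the trajectory with first switching angle
`θ₁` runs from `(1, 0)` to `(rτ, θτ)`. -/
structure OneSwitchEquations (m rτ θτ κ θ₁ θ₂ : ℝ) : Prop where
  angles : SwitchingAngles m κ θ₁ θ₂
  first_lt : θ₁ < θτ
  lt_second : θτ < θ₂
  radius : rτ = regularRatio κ 0 θ₁ * saturatedRatio m θ₁ θτ

/-- `κ, θ₁, θ₂` are determined by the two-switching equations, and the corresponding switched law is
the minimum-energy feedback. -/
structure OptimalTwoSwitchings (m rτ θτ κ θ₁ θ₂ : ℝ) : Prop where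
  equations : TwoSwitchEquations m rτ θτ κ θ₁ θ₂
  unique : ∀ κ' θ₁' θ₂' : ℝ, TwoSwitchEquations m rτ θτ κ' θ₁' θ₂' →
    κ' = κ ∧ θ₁' = θ₁ ∧ θ₂' = θ₂
  optimal : IsMinimumEnergyFeedback m rτ θτ (switchedLaw m κ θ₁ θ₂)

/-- The same for the one-switching equations. -/
structure OptimalOneSwitching (m rτ θτ κ θ₁ θ₂ : ℝ) : Prop where
  equations : OneSwitchEquations m rτ θτ κ θ₁ θ₂
  unique : ∀ κ' θ₁' θ₂' : ℝ, OneSwitchEquations m rτ θτ κ' θ₁' θ₂' →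
    κ' = κ ∧ θ₁' = θ₁ ∧ θ₂' = θ₂
  optimal : IsMinimumEnergyFeedback m rτ θτ (switchedLaw m κ θ₁ θ₂)

/-! The threshold radii, on the axis `θ = π` (`rC`) and on the axis `θ = π / 2` (`rD`). -/

noncomputable def rC1 (m : ℝ) : ℝ := exp (-π / √(4 * m ^ 2 - 1))

noncomputable def rC2 (m : ℝ) : ℝ := (m - 1) / (m + 1)

noncomputable def rD1 (m : ℝ) : ℝ :=
  exp (-(1 / √(4 * m ^ 2 - 1)) * (π - arccot (1 / √(4 * m ^ 2 - 1))))

noncomputable def rD2 (m : ℝ) : ℝ :=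
  √(m ^ 2 + 2) / (1 + √(m ^ 2 + 1)) *
    exp (-(1 / √(4 * m ^ 2 - 1)) * arccot ((m ^ 2 - 1) / √(4 * m ^ 2 - 1)))

noncomputable def rD3 (m : ℝ) : ℝ := √(m ^ 2 - 1) / (m + 1)

end BlochPulse

open BlochPulse

/-! Attach the multiplier `κ ^ 2 / 2` to the constraint on `log r`: the problem becomes the
minimisation of the integral of `u ^ 2 / 2 + κ ^ 2 / 2 * sin θ ^ 2` with free duration. The
Hamiltonian then vanishes, and as the only remaining state is the angle, the Hamilton-Jacobi
equation is algebraic in the costate. Without a bound on `u` the costate equals `u` and solves a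
quadratic equation whose root of positive angular speed is `regularLaw κ`; the bound turns the
optimal law into `min m (regularLaw κ)`.

The costate depends on the angle alone, so it has a potential. Integrating the Hamilton-Jacobi
inequality along an arbitrary transfer bounds its energy from below (`IsTransfer.calibration`,
`leastEnergy_le`), and the defect dominates the squared deviation from the law
(`sq_sub_min_regularLaw_le`), which gives uniqueness. The bound is attained by a trajectory built by
inverting time as a function of the angle (`exists_transfer_leastEnergy`), and approximated in
finite time by keeping the angular speed away from zero (`exists_transfer_Icc_energy_le`).

The radius reached for the parameter `κ` is `exp (-totalDecay m κ θτ)`. It is continuous and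
strictly increasing in `κ`, tends to `0` as `κ → 0` and to the radius of the control `u = m` as `κ →
∞`, so each smaller radius fixes one `κ`. Calibration with the energy weighted by `0` shows that no
radius beyond that limit is reachable (`saturated_bound`).

Finally `regularLaw κ` exceeds `m` exactly where `(m * cot θ - 1) ^ 2 < κ ^ 2 - (m ^ 2 - 1)`: an
interval of angles, empty iff `κ ^ 2 ≤ m ^ 2 - 1`, which cannot happen for `m < 1`. The threshold
radii belong to `κ ^ 2 = m ^ 2 - 1` (`rC2`, `rD3`), to `κ = m`, where `θ₂ = π / 2` (`rD2`), and to
`κ = ∞` (`rC1`, `rD1`). -/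

namespace BlochPulse

/-! ### Arbitrary transfers: integration along the angle and calibration. -/

namespace IsTransfer

variable {m rτ θτ : ℝ} {I : Set ℝ} {u a θ : ℝ → ℝ}

lemma uIcc_subset (h : IsTransfer m rτ θτ I u a θ) {s t : ℝ} (hs : s ∈ I) (ht : t ∈ I) :
    uIcc s t ⊆ I :=
  have := h.interval
  OrdConnected.uIcc_subset this hs ht

lemma measurableSet (h : IsTransfer m rτ θτ I u a θ) : MeasurableSet I :=
  h.interval.measurableSet

lemma aestronglyMeasurable_control (h : IsTransfer m rτ θτ I u a θ) {s t : ℝ} (hs : s ∈ I)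
    (ht : t ∈ I) : AEStronglyMeasurable u (volume.restrict (uIoc s t)) :=
  (h.measurable_control.mono_set
    (uIoc_subset_uIcc.trans (h.uIcc_subset hs ht))).aestronglyMeasurable

lemma intervalIntegrable_control (h : IsTransfer m rτ θτ I u a θ) {s t : ℝ} (hs : s ∈ I)
    (ht : t ∈ I) : IntervalIntegrable u volume s t := by
  rw [intervalIntegrable_iff]
  have : IsFiniteMeasure (volume.restrict (uIoc s t)) := by rw [uIoc]; infer_instance
  refine Integrable.of_bound (h.aestronglyMeasurable_control hs ht) m ?_
  filter_upwards [ae_restrict_mem measurableSet_uIoc] with x hx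
  exact h.bound x (h.uIcc_subset hs ht (uIoc_subset_uIcc hx))

lemma intervalIntegrable_control_sq (h : IsTransfer m rτ θτ I u a θ) {s t : ℝ} (hs : s ∈ I)
    (ht : t ∈ I) : IntervalIntegrable (fun x => u x ^ 2 / 2) volume s t := by
  rw [intervalIntegrable_iff]
  have : IsFiniteMeasure (volume.restrict (uIoc s t)) := by rw [uIoc]; infer_instance
  refine Integrable.of_bound (((h.aestronglyMeasurable_control hs ht).pow 2).mul_const (2⁻¹))
    (m ^ 2 / 2) ?_
  filter_upwards [ae_restrict_mem measurableSet_uIoc] with x hx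
  have h1 := h.bound x (h.uIcc_subset hs ht (uIoc_subset_uIcc hx))
  rw [norm_of_nonneg (by positivity)]
  have h2 := sq_le_sq' (abs_le.1 h1).1 (abs_le.1 h1).2
  linarith

lemma continuousOn_comp (h : IsTransfer m rτ θτ I u a θ) {s t : ℝ} (hs : s ∈ I)
    (ht : t ∈ I) {p : ℝ → ℝ} (hp : Continuous p) : ContinuousOn (fun x => p (θ x)) (uIcc s t) :=
  hp.comp_continuousOn (h.continuous_angle.mono (h.uIcc_subset hs ht))

lemma intervalIntegrable_speed (h : IsTransfer m rτ θτ I u a θ) {s t : ℝ} (hs : s ∈ I)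
    (ht : t ∈ I) :
    IntervalIntegrable (fun x => u x - sin (θ x) * cos (θ x)) volume s t :=
  (h.intervalIntegrable_control hs ht).sub
    (h.continuousOn_comp hs ht (by fun_prop : Continuous fun y => sin y * cos y)).intervalIntegrable

lemma abs_speed_le (h : IsTransfer m rτ θτ I u a θ) {t : ℝ} (ht : t ∈ I) :
    |u t - sin (θ t) * cos (θ t)| ≤ m + 1 := by
  have h1 := h.bound t ht
  have h2 : |sin (θ t) * cos (θ t)| ≤ 1 := by
    rw [abs_mul]
    exact mul_le_one₀ (abs_sin_le_one _) (abs_nonneg _) (abs_cos_le_one _)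
  exact (abs_sub _ _).trans (by linarith)

lemma abs_angle_sub_le (h : IsTransfer m rτ θτ I u a θ) {s t : ℝ} (hs : s ∈ I) (ht : t ∈ I) :
    |θ t - θ s| ≤ (m + 1) * |t - s| := by
  rw [h.angle s hs t ht]
  exact intervalIntegral.norm_integral_le_of_norm_le_const
    (f := fun x => u x - sin (θ x) * cos (θ x)) fun x hx => h.abs_speed_le (h.uIcc_subset hs ht (uIoc_subset_uIcc hx))

lemma ae_hasDerivAt_angle (h : IsTransfer m rτ θτ I u a θ) {s t : ℝ} (hs : s ∈ I) (ht : t ∈ I) :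
    ∀ᵐ x, x ∈ Ioo s t → HasDerivAt θ (u x - sin (θ x) * cos (θ x)) x := by
  filter_upwards [(h.intervalIntegrable_speed hs ht).ae_hasDerivAt_integral] with x hx hxs
  have hst := hxs.1.trans hxs.2
  have hd := (hx (by rw [uIcc_of_le hst.le]; exact Ioo_subset_Icc_self hxs) s left_mem_uIcc)
  refine (hd.const_add (θ s)).congr_of_eventuallyEq ?_
  filter_upwards [isOpen_Ioo.mem_nhds hxs] with y hy
  rw [← h.angle s hs y (h.uIcc_subset hs ht (by
    rw [uIcc_of_le hst.le]; exact Ioo_subset_Icc_self hy))]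
  ring

/-- The control is merely measurable, so `θ` is differentiable only almost everywhere. The
fundamental theorem still applies because `P ∘ θ` is Lipschitz, hence absolutely continuous. -/
lemma integral_comp_angle (h : IsTransfer m rτ θτ I u a θ) {s t : ℝ} (hs : s ∈ I) (ht : t ∈ I)
    (hst : s ≤ t) {p P : ℝ → ℝ} (hp : Continuous p) (hP : ∀ x, HasDerivAt P (p x) x) :
    ∫ x in s..t, p (θ x) * (u x - sin (θ x) * cos (θ x)) = P (θ t) - P (θ s) := by
  have hsub := h.uIcc_subset hs ht
  obtain ⟨c, hc⟩ := (isCompact_uIcc.image_of_continuousOn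
    (h.continuous_angle.mono hsub)).isBounded.subset_closedBall 0
  obtain ⟨C, hC⟩ := (isCompact_closedBall (0 : ℝ) c).exists_bound_of_continuousOn hp.continuousOn
  have hC0 : 0 ≤ C := (norm_nonneg _).trans (hC (θ s) (hc ⟨s, left_mem_uIcc, rfl⟩))
  have hLip : LipschitzOnWith (C * (m + 1)).toNNReal (fun x => P (θ x)) (uIcc s t) := by
    refine LipschitzOnWith.of_dist_le_mul fun x hx y hy => ?_
    have hm : 0 ≤ m + 1 := (abs_nonneg _).trans (h.abs_speed_le hs)
    rw [coe_toNNReal _ (by positivity), dist_eq, dist_eq]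
    have h1 := (convex_closedBall (0 : ℝ) c).norm_image_sub_le_of_norm_hasDerivWithin_le
      (fun z _ => (hP z).hasDerivWithinAt) hC (hc ⟨y, hy, rfl⟩) (hc ⟨x, hx, rfl⟩)
    have h2 := h.abs_angle_sub_le (hsub hy) (hsub hx)
    simp only [norm_eq_abs] at h1
    calc _ ≤ C * |θ x - θ y| := h1
      _ ≤ C * ((m + 1) * |x - y|) := by gcongr
      _ = _ := by ring
  rw [← hLip.absolutelyContinuousOnInterval.integral_deriv_eq_sub]
  refine intervalIntegral.integral_congr_ae ?_
  have hne : ∀ᵐ x : ℝ, x ≠ t := by simp [ae_iff, measure_singleton]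
  filter_upwards [h.ae_hasDerivAt_angle hs ht, hne] with x hx hxt hxs
  rw [uIoc_of_le hst] at hxs
  exact (((hP (θ x)).comp x (hx ⟨hxs.1, lt_of_le_of_ne hxs.2 hxt⟩)).deriv).symm

/-- By continuity, the times spent in an open band of angles that is crossed form a nonempty open
set, which has positive measure. -/
lemma exists_mem_of_ae (h : IsTransfer m rτ θτ I u a θ) {s t y₁ y₂ : ℝ} (hs : s ∈ I)
    (ht : t ∈ I) (hy : y₁ < y₂) (h₁ : min (θ s) (θ t) ≤ y₁) (h₂ : y₂ ≤ max (θ s) (θ t))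
    {Q : ℝ → Prop} (hQ : ∀ᵐ x ∂volume.restrict I, Q x) : ∃ x ∈ I, θ x ∈ Ioo y₁ y₂ ∧ Q x := by
  have hsub := h.uIcc_subset hs ht
  have hc := h.continuous_angle.mono hsub
  set W := Ioo (min s t) (max s t) ∩ θ ⁻¹' Ioo y₁ y₂ with hW
  have hIW : W ⊆ I := fun x hx => hsub (Ioo_subset_Icc_self hx.1)
  have hopen : IsOpen W :=
    (hc.mono Ioo_subset_Icc_self).isOpen_inter_preimage isOpen_Ioo isOpen_Ioo
  have hne : W.Nonempty := by
    obtain ⟨y, hy1, hy2⟩ := exists_between hy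
    obtain ⟨x, hx, rfl⟩ := intermediate_value_uIcc hc (show y ∈ uIcc (θ s) (θ t) from
      ⟨h₁.trans hy1.le, hy2.le.trans h₂⟩)
    refine ⟨x, ⟨lt_of_le_of_ne hx.1 ?_, lt_of_le_of_ne hx.2 ?_⟩, hy1, hy2⟩ <;> rintro rfl <;>
      rcases le_total s t with hst | hst <;> rcases le_total (θ s) (θ t) with hθ | hθ <;>
      simp_all <;> linarith
  by_contra! hcon
  have hnull : volume W = 0 := by
    rw [ae_restrict_iff' h.measurableSet, ae_iff] at hQ
    exact measure_mono_null (fun x hx => by simpa using ⟨hIW hx, hcon x (hIW hx) hx.2⟩) hQ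
  exact (hopen.measure_pos volume hne).ne' hnull

lemma exists_angle_lt (h : IsTransfer m rτ θτ I u a θ) {y : ℝ} (hy : 0 < y) : ∃ t ∈ I, θ t < y := by
  have : Nonempty I := h.nonempty.to_subtype
  obtain ⟨t, ht⟩ := (h.start_angle.eventually_lt_const hy).exists
  exact ⟨t, t.2, ht⟩

lemma exists_lt_angle_of_neg (h : IsTransfer m rτ θτ I u a θ) {y : ℝ} (hy : y < 0) :
    ∃ t ∈ I, y < θ t := by
  have : Nonempty I := h.nonempty.to_subtype
  obtain ⟨t, ht⟩ := (h.start_angle.eventually_const_lt hy).exists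
  exact ⟨t, t.2, ht⟩

lemma exists_lt_angle (h : IsTransfer m rτ θτ I u a θ) {y : ℝ} (hy : y < θτ) :
    ∃ t ∈ I, y < θ t := by
  have : Nonempty I := h.nonempty.to_subtype
  obtain ⟨t, ht⟩ := (h.final_angle.eventually_const_lt hy).exists
  exact ⟨t, t.2, ht⟩

lemma exists_angle_lt_of_gt (h : IsTransfer m rτ θτ I u a θ) {y : ℝ} (hy : θτ < y) :
    ∃ t ∈ I, θ t < y := by
  have : Nonempty I := h.nonempty.to_subtype
  obtain ⟨t, ht⟩ := (h.final_angle.eventually_lt_const hy).exists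
  exact ⟨t, t.2, ht⟩

/-- Properties that hold almost everywhere on a transfer hold somewhere in each range of angles
between the end points. -/
lemma exists_mem_Ioo_of_ae (h : IsTransfer m rτ θτ I u a θ) {y₁ y₂ : ℝ} (h0 : 0 < y₁)
    (hy : y₁ < y₂) (hτ : y₂ < θτ) {Q : ℝ → Prop} (hQ : ∀ᵐ x ∂volume.restrict I, Q x) :
    ∃ x ∈ I, θ x ∈ Ioo y₁ y₂ ∧ Q x := by
  obtain ⟨s, hs, hs'⟩ := h.exists_angle_lt h0
  obtain ⟨t, ht, ht'⟩ := h.exists_lt_angle hτ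
  exact h.exists_mem_of_ae hs ht hy (min_le_of_left_le hs'.le) (le_max_of_le_right ht'.le) hQ

/-- A trajectory that leaves the interval must cross part of an adjacent strip, and would spend
positive time there. -/
lemma angle_mem_Icc (h : IsTransfer m rτ θτ I u a θ)
    (hQ : ∀ᵐ t ∂volume.restrict I, θ t ∉ Ioo (-π) 0 ∧ θ t ∉ Ioo θτ (θτ + π / 2)) :
    ∀ t ∈ I, θ t ∈ Icc 0 θτ := by
  have hπ := pi_pos
  intro t ht
  constructor
  · by_contra! hneg
    -- Truncating at `-π` keeps the crossed band inside the strip covered by `hQ`.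
    set y := max (θ t) (-π) with hy
    have hy0 : y < 0 := max_lt hneg (by linarith)
    have hyt : θ t ≤ y := le_max_left _ _
    have hyp : -π ≤ y := le_max_right _ _
    obtain ⟨s, hs, hs'⟩ := h.exists_lt_angle_of_neg (y := y / 2) (by linarith)
    obtain ⟨x, -, hx, hx', -⟩ := h.exists_mem_of_ae (y₁ := y) (y₂ := y / 2) ht hs (by linarith)
      (min_le_of_left_le hyt) (le_max_of_le_right hs'.le) hQ
    exact hx' ⟨by linarith [hx.1], by linarith [hx.2]⟩
  · by_contra! hgt
    set y := min (θ t) (θτ + π / 2) with hy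
    have hy0 : θτ < y := lt_min hgt (by linarith)
    have hyt : y ≤ θ t := min_le_left _ _
    have hyp : y ≤ θτ + π / 2 := min_le_right _ _
    obtain ⟨s, hs, hs'⟩ := h.exists_angle_lt_of_gt (y := (θτ + y) / 2) (by linarith)
    obtain ⟨x, -, hx, -, hx'⟩ := h.exists_mem_of_ae (y₁ := (θτ + y) / 2) (y₂ := y) ht hs
      (by linarith) (min_le_of_right_le hs'.le) (le_max_of_le_left hyt) hQ
    exact hx' ⟨by linarith [hx.1], by linarith [hx.2]⟩

/-- Calibration: a pointwise lower bound for the running cost by an exact form integrates to a lower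
bound for the total cost, and equality of the totals forces equality almost everywhere. -/
lemma calibration (h : IsTransfer m rτ θτ I u a θ) {p P : ℝ → ℝ} (hp : Continuous p)
    (hP : ∀ x, HasDerivAt P (p x) x) {c l E : ℝ}
    (hg : ∀ᵐ t ∂volume.restrict I, p (θ t) * (u t - sin (θ t) * cos (θ t)) ≤
      c * (u t ^ 2 / 2) + l * sin (θ t) ^ 2)
    (hE : ∀ s ∈ I, ∀ t ∈ I, s ≤ t → ∫ x in s..t, c * (u x ^ 2 / 2) ≤ E) :
    P θτ - P 0 + l * log rτ ≤ E ∧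
    (E ≤ P θτ - P 0 + l * log rτ → ∀ᵐ t ∂volume.restrict I,
      p (θ t) * (u t - sin (θ t) * cos (θ t)) = c * (u t ^ 2 / 2) + l * sin (θ t) ^ 2) := by
  set g : ℝ → ℝ := fun t => c * (u t ^ 2 / 2) + l * sin (θ t) ^ 2 -
    p (θ t) * (u t - sin (θ t) * cos (θ t)) with hgdef
  have hi1 : ∀ s ∈ I, ∀ t ∈ I, IntervalIntegrable (fun t => c * (u t ^ 2 / 2)) volume s t :=
    fun s hs t ht => (h.intervalIntegrable_control_sq hs ht).const_mul c
  have hi2 : ∀ s ∈ I, ∀ t ∈ I, IntervalIntegrable (fun t => l * sin (θ t) ^ 2) volume s t :=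
    fun s hs t ht => (h.continuousOn_comp hs ht
      (by fun_prop : Continuous fun y => l * sin y ^ 2)).intervalIntegrable
  have hi3 : ∀ s ∈ I, ∀ t ∈ I, IntervalIntegrable
      (fun t => p (θ t) * (u t - sin (θ t) * cos (θ t))) volume s t :=
    fun s hs t ht => (h.intervalIntegrable_speed hs ht).continuousOn_mul
      (h.continuousOn_comp hs ht hp)
  have hi : ∀ s ∈ I, ∀ t ∈ I, IntervalIntegrable g volume s t :=
    fun s hs t ht => ((hi1 s hs t ht).add (hi2 s hs t ht)).sub (hi3 s hs t ht)
  have hint : ∀ s ∈ I, ∀ t ∈ I, s ≤ t → ∫ x in s..t, g x =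
      (∫ x in s..t, c * (u x ^ 2 / 2)) - l * (a t - a s) - (P (θ t) - P (θ s)) := by
    intro s hs t ht hst
    rw [hgdef, intervalIntegral.integral_sub ((hi1 s hs t ht).add (hi2 s hs t ht)) (hi3 s hs t ht),
      intervalIntegral.integral_add (hi1 s hs t ht) (hi2 s hs t ht),
      h.integral_comp_angle hs ht hst hp hP, intervalIntegral.integral_const_mul l,
      h.logRadius s hs t ht, intervalIntegral.integral_neg]
    ring
  have hg0 : ∀ᵐ t ∂volume.restrict I, 0 ≤ g t := by
    filter_upwards [hg] with t ht
    simp only [hgdef]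
    linarith
  have hnn : ∀ s ∈ I, ∀ t ∈ I, ∀ᵐ x ∂volume.restrict (Ioc s t), 0 ≤ g x := fun s hs t ht =>
    ae_restrict_of_ae_restrict_of_subset (s := Ioc s t) (fun x hx =>
      h.interval.out hs ht (Ioc_subset_Icc_self hx)) hg0
  have hP' : Continuous P := continuous_iff_continuousAt.2 fun x => (hP x).continuousAt
  have hne : Nonempty I := h.nonempty.to_subtype
  -- Since `g ≥ 0`, its integral only grows when `[s, t]` expands towards the ends of `I`, where the
  -- boundary values determine the limit of the bound.
  have key : ∀ s ∈ I, ∀ t ∈ I, s ≤ t →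
      ∫ x in s..t, g x ≤ E - (P θτ - P 0 + l * log rτ) := by
    intro s hs t ht hst
    have hlim : Tendsto (fun z : I × I => E - l * (a z.2 - a z.1) - (P (θ z.2) - P (θ z.1)))
        (atBot ×ˢ atTop) (𝓝 (E - l * (log rτ - 0) - (P θτ - P 0))) :=
      ((tendsto_const_nhds).sub (((h.final_logRadius.comp tendsto_snd).sub
        (h.start_logRadius.comp tendsto_fst)).const_mul l)).sub
        (((hP'.tendsto _).comp (h.final_angle.comp tendsto_snd)).sub
          ((hP'.tendsto _).comp (h.start_angle.comp tendsto_fst)))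
    have : ∫ x in s..t, g x ≤ E - l * (log rτ - 0) - (P θτ - P 0) := by
      refine ge_of_tendsto hlim ?_
      filter_upwards [(eventually_le_atBot (⟨s, hs⟩ : I)).prod_mk
        (eventually_ge_atTop (⟨t, ht⟩ : I))] with z hz
      have hz1 : (z.1 : ℝ) ≤ s := hz.1
      have hz2 : t ≤ (z.2 : ℝ) := hz.2
      have hz3 := hz1.trans (hst.trans hz2)
      have e1 := hint _ z.1.2 _ z.2.2 hz3
      have e2 := hE _ z.1.2 _ z.2.2 hz3
      have e3 : ∫ x in s..t, g x ≤ ∫ x in (z.1 : ℝ)..z.2, g x :=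
        intervalIntegral.integral_mono_interval hz1 hst hz2
          (hnn _ z.1.2 _ z.2.2) (hi _ z.1.2 _ z.2.2)
      linarith
    linarith
  constructor
  · obtain ⟨t, ht⟩ := h.nonempty
    have := key t ht t ht le_rfl
    rw [intervalIntegral.integral_same] at this
    linarith
  · intro hle
    suffices ∀ᵐ t ∂volume.restrict I, g t = 0 by
      filter_upwards [this] with t ht
      simp only [hgdef] at ht
      linarith
    -- Compact subintervals suffice, so integrability of `g` on all of `I` is not needed.
    refine ae_restrict_of_ae_restrict_inter_Ioo fun s t hs ht hst => ?_
    have h0 : ∫ x in s..t, g x = 0 := by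
      refine le_antisymm ((key s hs t ht hst.le).trans (by linarith)) ?_
      exact intervalIntegral.integral_nonneg_of_ae_restrict hst.le
        (ae_restrict_of_ae_restrict_of_subset (s := Icc s t) (h.interval.out hs ht) hg0)
    have h1 := (intervalIntegral.integral_eq_zero_iff_of_le_of_nonneg_ae hst.le
      (hnn s hs t ht) (hi s hs t ht)).1 h0
    exact ae_restrict_of_ae_restrict_of_subset
      (fun x hx => Ioo_subset_Ioc_self hx.2) h1

lemma ofReal_integral_le_energy (h : IsTransfer m rτ θτ I u a θ) {s t : ℝ} (hs : s ∈ I)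
    (ht : t ∈ I) (hst : s ≤ t) :
    ENNReal.ofReal (∫ x in s..t, u x ^ 2 / 2) ≤ energy I u := by
  rw [intervalIntegral.integral_of_le hst, ofReal_integral_eq_lintegral_ofReal
    ((intervalIntegrable_iff_integrableOn_Ioc_of_le hst).1 (h.intervalIntegrable_control_sq hs ht))
    (by filter_upwards with x; positivity)]
  exact lintegral_mono_set fun x hx => h.interval.out hs ht (Ioc_subset_Icc_self hx)

lemma integral_le_energy_toReal (h : IsTransfer m rτ θτ I u a θ) (hfin : energy I u ≠ ⊤) {s t : ℝ}
    (hs : s ∈ I) (ht : t ∈ I) (hst : s ≤ t) :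
    ∫ x in s..t, 1 * (u x ^ 2 / 2) ≤ (energy I u).toReal := by
  simp only [one_mul]
  exact (ENNReal.ofReal_le_iff_le_toReal hfin).1 (h.ofReal_integral_le_energy hs ht hst)

end IsTransfer


/-! ### Construction of transfers with the angle as clock. -/

/-- A transfer whose angle runs through `K`, as the inverse function of the elapsed time `T`. The
integrand `w = T'` is the reciprocal of the angular speed. -/
lemma exists_transfer_of_time {m rτ θτ : ℝ} {J K : Set ℝ} {w T A : ℝ → ℝ} (hJ : IsOpen J)
    (hJc : J.OrdConnected) (hKJ : K ⊆ J) (hK : K.OrdConnected) (hKne : K.Nonempty)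
    (hw : ContinuousOn w J) (hw0 : ∀ x ∈ J, 0 < w x) (hT : ∀ x ∈ J, HasDerivAt T (w x) x)
    (hA : ∀ x ∈ J, HasDerivAt A (-(sin x ^ 2 * w x)) x)
    (hm : ∀ x ∈ K, |1 / w x + sin x * cos x| ≤ m)
    (h0 : Tendsto (fun x : K => (x : ℝ)) atBot (𝓝 0))
    (hτ : Tendsto (fun x : K => (x : ℝ)) atTop (𝓝 θτ))
    (hA0 : Tendsto (fun x : K => A x) atBot (𝓝 0))
    (hAτ : Tendsto (fun x : K => A x) atTop (𝓝 (log rτ))) :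
    ∃ θ : ℝ → ℝ,
      IsTransfer m rτ θτ (T '' K) (fun t => 1 / w (θ t) + sin (θ t) * cos (θ t))
        (fun t => A (θ t)) θ ∧
      (∀ t ∈ T '' K, θ t ∈ K) ∧
      energy (T '' K) (fun t => 1 / w (θ t) + sin (θ t) * cos (θ t)) =
        ∫⁻ x in K, ENNReal.ofReal (w x * ((1 / w x + sin x * cos x) ^ 2 / 2)) := by
  have hTc : ContinuousOn T J := fun x hx => (hT x hx).continuousAt.continuousWithinAt
  have hmono : StrictMonoOn T J := by
    refine strictMonoOn_of_deriv_pos hJc.convex hTc fun x hx => ?_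
    rw [(hT x (interior_subset hx)).deriv]
    exact hw0 x (interior_subset hx)
  set θ := Function.invFunOn T J with hθ
  have hθT : ∀ x ∈ J, θ (T x) = x := fun x hx => hmono.injOn.leftInvOn_invFunOn hx
  have himg : ∀ x ∈ J, T '' J ∈ 𝓝 (T x) := by
    intro x hx
    have hs : HasStrictDerivAt T (w x) x := hasStrictDerivAt_of_hasDerivAt_of_continuousAt
      (by filter_upwards [hJ.mem_nhds hx] with y hy using hT y hy)
      (hw.continuousAt (hJ.mem_nhds hx))
    rw [← hs.map_nhds_eq (hw0 x hx).ne']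
    exact image_mem_map (hJ.mem_nhds hx)
  have hθmono : MonotoneOn θ (T '' J) := by
    rintro _ ⟨x, hx, rfl⟩ _ ⟨y, hy, rfl⟩ hxy
    rw [hθT x hx, hθT y hy]
    exact (hmono.le_iff_le hx hy).1 hxy
  have hθimg : θ '' (T '' J) = J := by
    rw [image_image]
    ext x
    constructor
    · rintro ⟨y, hy, rfl⟩
      simpa only [hθT y hy] using hy
    · exact fun hx => ⟨x, hx, hθT x hx⟩
  -- A monotone function whose image is a neighbourhood of the value has no jump.
  have hθc : ∀ x ∈ J, ContinuousAt θ (T x) := fun x hx =>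
    continuousAt_of_monotoneOn_of_image_mem_nhds hθmono (himg x hx)
      (by rw [hθimg, hθT x hx]; exact hJ.mem_nhds hx)
  have hθd : ∀ x ∈ J, HasDerivAt θ (w x)⁻¹ (T x) := by
    intro x hx
    refine HasDerivAt.of_local_left_inverse (f := T) (hθc x hx) ?_ (hw0 x hx).ne' ?_
    · rw [hθT x hx]; exact hT x hx
    · filter_upwards [himg x hx]
      rintro _ ⟨y, hy, rfl⟩
      rw [hθT y hy]
  have hIc : (T '' K).OrdConnected :=
    (hK.isPreconnected.image T (hTc.mono hKJ)).ordConnected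
  have hθK : ∀ t ∈ T '' K, θ t ∈ K := by
    rintro _ ⟨x, hx, rfl⟩
    rwa [hθT x (hKJ hx)]
  have hθcI : ContinuousOn θ (T '' K) := by
    rintro _ ⟨x, hx, rfl⟩
    exact (hθc x (hKJ hx)).continuousWithinAt
  have hwI : ContinuousOn (fun t => w (θ t)) (T '' K) :=
    hw.comp hθcI fun t ht => hKJ (hθK t ht)
  have hwI0 : ∀ t ∈ T '' K, w (θ t) ≠ 0 := fun t ht => (hw0 _ (hKJ (hθK t ht))).ne'
  have huI : ContinuousOn (fun t => 1 / w (θ t) + sin (θ t) * cos (θ t)) (T '' K) :=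
    (continuousOn_const.div hwI hwI0).add
      ((continuous_sin.comp_continuousOn hθcI).mul (continuous_cos.comp_continuousOn hθcI))
  have hθd' : ∀ t ∈ T '' K, HasDerivAt θ (w (θ t))⁻¹ t := by
    rintro _ ⟨x, hx, rfl⟩
    have := hθd x (hKJ hx)
    rwa [hθT x (hKJ hx)]
  have hAd : ∀ t ∈ T '' K, HasDerivAt (fun t => A (θ t)) (-(sin (θ t)) ^ 2) t := by
    intro t ht
    have h1 := (hA _ (hKJ (hθK t ht))).comp t (hθd' t ht)
    have h2 := hwI0 t ht
    have h3 : -(sin (θ t)) ^ 2 = -(sin (θ t) ^ 2 * w (θ t)) * (w (θ t))⁻¹ := by field_simp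
    rw [h3]
    exact h1
  set e : K ≃o T '' K := (hmono.mono hKJ).orderIso T K with he
  have hesymm : ∀ t : T '' K, (e.symm t : ℝ) = θ t := by
    intro t
    obtain ⟨x, rfl⟩ := e.surjective t
    rw [e.symm_apply_apply]
    exact (hθT x (hKJ x.2)).symm
  refine ⟨θ, ⟨hIc, hKne.image T, huI.aemeasurable hIc.measurableSet, ?_, hθcI, ?_, ?_, ?_, ?_, ?_,
    ?_⟩, hθK, ?_⟩
  · exact fun t ht => hm _ (hθK t ht)
  · intro s hs t ht
    have hsub := hIc.uIcc_subset hs ht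
    rw [intervalIntegral.integral_congr (g := fun x => (w (θ x))⁻¹) (fun x _ => by simp),
      intervalIntegral.integral_eq_sub_of_hasDerivAt (fun x hx => hθd' x (hsub hx))
      ((hwI.inv₀ hwI0).mono hsub).intervalIntegrable]
  · intro s hs t ht
    have hsub := hIc.uIcc_subset hs ht
    rw [intervalIntegral.integral_eq_sub_of_hasDerivAt (fun x hx => hAd x (hsub hx))
      (((continuous_sin.comp_continuousOn hθcI).pow 2).neg.mono hsub).intervalIntegrable]
  · convert hA0.comp e.symm.tendsto_atBot using 2 with t
    simp [hesymm]
  · convert h0.comp e.symm.tendsto_atBot using 2 with t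
    simp [hesymm]
  · convert hAτ.comp e.symm.tendsto_atTop using 2 with t
    simp [hesymm]
  · convert hτ.comp e.symm.tendsto_atTop using 2 with t
    simp [hesymm]
  -- Change of variables `t = T x`.
  · rw [energy, lintegral_image_eq_lintegral_abs_deriv_mul hK.measurableSet
      (fun x hx => (hT x (hKJ hx)).hasDerivWithinAt) (hmono.injOn.mono hKJ)]
    refine setLIntegral_congr_fun hK.measurableSet fun x hx => ?_
    have hx' := hKJ hx
    simp only [hθT x hx']
    rw [abs_of_pos (hw0 x hx'), ENNReal.ofReal_mul (hw0 x hx').le]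

/-- A transfer with prescribed reciprocal angular speed `w`, possibly of infinite duration. -/
lemma exists_transfer_Ioo {m θτ : ℝ} {w f : ℝ → ℝ} (hτ : 0 < θτ) (hw : ContinuousOn w (Ioo 0 θτ))
    (hw0 : ∀ x ∈ Ioo 0 θτ, 0 < w x) (hm : ∀ x ∈ Ioo 0 θτ, |1 / w x + sin x * cos x| ≤ m)
    (hf : Continuous f) (hfw : ∀ x ∈ Ioo 0 θτ, f x = sin x ^ 2 * w x) :
    ∃ (I : Set ℝ) (u a θ : ℝ → ℝ), IsTransfer m (exp (-∫ x in 0..θτ, f x)) θτ I u a θ ∧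
      (∀ t ∈ I, θ t ∈ Ioo 0 θτ ∧ u t = 1 / w (θ t) + sin (θ t) * cos (θ t)) ∧
      energy I u = ∫⁻ x in Ioo 0 θτ, ENNReal.ofReal
        (w x * ((1 / w x + sin x * cos x) ^ 2 / 2)) := by
  have hA : ∀ x, HasDerivAt (fun x => -∫ y in 0..x, f y) (-(f x)) x := fun x =>
    (hf.integral_hasStrictDerivAt 0 x).hasDerivAt.neg
  have hAc : Continuous (fun x => -∫ y in 0..x, f y) :=
    continuous_iff_continuousAt.2 fun x => (hA x).continuousAt
  have hbot : Tendsto (fun x : Ioo 0 θτ => (x : ℝ)) atBot (𝓝 0) := by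
    have := (tendsto_comp_coe_Ioo_atBot (f := id) (l := 𝓝 (0 : ℝ)) hτ).2
      (tendsto_id.mono_left nhdsWithin_le_nhds)
    simpa using this
  have htop : Tendsto (fun x : Ioo 0 θτ => (x : ℝ)) atTop (𝓝 θτ) := by
    have := (tendsto_comp_coe_Ioo_atTop (f := id) (l := 𝓝 θτ) hτ).2
      (tendsto_id.mono_left nhdsWithin_le_nhds)
    simpa using this
  -- Time is counted from the middle angle because `w` may fail to be integrable at both ends.
  have hc : θτ / 2 ∈ Ioo 0 θτ := ⟨by linarith, by linarith⟩
  have hT : ∀ x ∈ Ioo 0 θτ, HasDerivAt (fun x => ∫ y in (θτ / 2)..x, w y) (w x) x := by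
    intro x hx
    have hsub : uIcc (θτ / 2) x ⊆ Ioo 0 θτ := ordConnected_Ioo.uIcc_subset hc hx
    exact intervalIntegral.integral_hasDerivAt_right (hw.mono hsub).intervalIntegrable
      (hw.stronglyMeasurableAtFilter isOpen_Ioo x hx) (hw.continuousAt (isOpen_Ioo.mem_nhds hx))
  obtain ⟨θ, h1, h2, h3⟩ := exists_transfer_of_time (rτ := exp (-∫ x in 0..θτ, f x)) isOpen_Ioo
    ordConnected_Ioo subset_rfl
    ordConnected_Ioo ⟨_, hc⟩ hw hw0 hT (fun x hx => by rw [← hfw x hx]; exact hA x) hm hbot htop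
    (by simpa [Function.comp_def] using (hAc.tendsto 0).comp hbot)
    (by rw [log_exp]; exact (hAc.tendsto θτ).comp htop)
  exact ⟨_, _, _, θ, h1, fun t ht => ⟨h2 t ht, rfl⟩, h3⟩

/-- A transfer with prescribed bounded reciprocal angular speed `w`, on a compact time interval. -/
lemma exists_transfer_Icc {m θτ : ℝ} {w : ℝ → ℝ} (hτ : 0 < θτ) (hw : Continuous w)
    (hw0 : ∀ x, 0 < w x) (hm : ∀ x ∈ Icc 0 θτ, |1 / w x + sin x * cos x| ≤ m) :
    ∃ (τ : ℝ) (u a θ : ℝ → ℝ), 0 < τ ∧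
      IsTransfer m (exp (-∫ x in 0..θτ, sin x ^ 2 * w x)) θτ (Icc 0 τ) u a θ ∧
      (∀ t ∈ Icc 0 τ, θ t ∈ Icc 0 θτ ∧ u t = 1 / w (θ t) + sin (θ t) * cos (θ t)) ∧
      energy (Icc 0 τ) u = ∫⁻ x in Icc 0 θτ, ENNReal.ofReal
        (w x * ((1 / w x + sin x * cos x) ^ 2 / 2)) := by
  have hT : ∀ x, HasDerivAt (fun x => ∫ y in 0..x, w y) (w x) x := fun x =>
    (hw.integral_hasStrictDerivAt 0 x).hasDerivAt
  have hf : Continuous fun x => sin x ^ 2 * w x := by fun_prop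
  have hA : ∀ x, HasDerivAt (fun x => -∫ y in 0..x, sin y ^ 2 * w y) (-(sin x ^ 2 * w x)) x :=
    fun x => (hf.integral_hasStrictDerivAt 0 x).hasDerivAt.neg
  have hmono : StrictMono fun x => ∫ y in 0..x, w y := by
    refine strictMono_of_deriv_pos fun x => ?_
    rw [(hT x).deriv]
    exact hw0 x
  have hTc : Continuous fun x => ∫ y in 0..x, w y :=
    continuous_iff_continuousAt.2 fun x => (hT x).continuousAt
  have hI : (fun x => ∫ y in 0..x, w y) '' Icc 0 θτ = Icc 0 (∫ y in 0..θτ, w y) := by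
    refine Subset.antisymm ?_ ?_
    · rintro _ ⟨x, hx, rfl⟩
      refine ⟨?_, hmono.monotone hx.2⟩
      simpa using hmono.monotone hx.1
    · simpa using intermediate_value_Icc hτ.le hTc.continuousOn
  -- This instance equips `Icc 0 θτ` with `⊥` and `⊤`, so that the end filters become principal at
  -- the end points.
  let _ : Fact ((0 : ℝ) ≤ θτ) := ⟨hτ.le⟩
  have hbot : (atBot : Filter (Icc 0 θτ)) = pure ⊥ := OrderBot.atBot_eq _
  have htop : (atTop : Filter (Icc 0 θτ)) = pure ⊤ := OrderTop.atTop_eq _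
  have hb : ((⊥ : Icc 0 θτ) : ℝ) = 0 := rfl
  have ht : ((⊤ : Icc 0 θτ) : ℝ) = θτ := rfl
  obtain ⟨θ, h1, h2, h3⟩ := exists_transfer_of_time (m := m) (θτ := θτ) (K := Icc 0 θτ)
    (rτ := exp (-∫ x in 0..θτ, sin x ^ 2 * w x)) isOpen_univ
    ordConnected_univ (subset_univ _) ordConnected_Icc ⟨0, le_rfl, hτ.le⟩ hw.continuousOn
    (fun x _ => hw0 x) (fun x _ => hT x) (fun x _ => hA x) hm
    (by rw [hbot, tendsto_pure_left, hb]; exact fun s hs => mem_of_mem_nhds hs)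
    (by rw [htop, tendsto_pure_left, ht]; exact fun s hs => mem_of_mem_nhds hs)
    (by rw [hbot, tendsto_pure_left, hb, intervalIntegral.integral_same, neg_zero]
        exact fun s hs => mem_of_mem_nhds hs)
    (by rw [htop, tendsto_pure_left, ht, log_exp]; exact fun s hs => mem_of_mem_nhds hs)
  rw [hI] at h1 h2 h3
  refine ⟨_, _, _, θ, ?_, h1, fun t ht => ⟨h2 t ht, rfl⟩, h3⟩
  simpa using hmono hτ


/-! ### Extremal speed, decay and costate, and the Hamilton-Jacobi inequality. -/

lemma sin_mul_cos_le (x : ℝ) : sin x * cos x ≤ 1 / 2 := by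
  nlinarith [sq_nonneg (sin x - cos x), sin_sq_add_cos_sq x]

lemma neg_le_sin_mul_cos (x : ℝ) : -(1 / 2) ≤ sin x * cos x := by
  nlinarith [sq_nonneg (sin x + cos x), sin_sq_add_cos_sq x]

lemma saturated_speed_pos {m : ℝ} (hm : 1 / 2 < m) (x : ℝ) : 0 < m - sin x * cos x := by
  linarith [sin_mul_cos_le x]

lemma sqrt_cos_pos {κ : ℝ} (hκ : 0 < κ) (x : ℝ) : 0 < √(cos x ^ 2 + κ ^ 2) :=
  sqrt_pos.2 (by positivity)

lemma le_sqrt_cos (κ x : ℝ) : κ ≤ √(cos x ^ 2 + κ ^ 2) :=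
  le_sqrt_of_sq_le (by nlinarith [sq_nonneg (cos x)])

lemma sq_sqrt_cos (κ x : ℝ) : √(cos x ^ 2 + κ ^ 2) ^ 2 = cos x ^ 2 + κ ^ 2 :=
  sq_sqrt (by positivity)

lemma cos_add_sqrt_pos {κ : ℝ} (hκ : 0 < κ) (x : ℝ) : 0 < cos x + √(cos x ^ 2 + κ ^ 2) := by
  have h : |cos x| < √(cos x ^ 2 + κ ^ 2) := by
    rw [← sqrt_sq_eq_abs]
    exact sqrt_lt_sqrt (sq_nonneg _) (by nlinarith [sq_pos_of_pos hκ])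
  linarith [neg_abs_le (cos x)]

/-- The angular speed under the law `min m (regularLaw κ)`, for angles in `[0, π]`. -/
noncomputable def speed (m κ x : ℝ) : ℝ :=
  min (m - sin x * cos x) (max (sin x) 0 * √(cos x ^ 2 + κ ^ 2))

/-- The rate of decay of the logarithmic radius with respect to the angle, under the law
`min m (regularLaw κ)`. -/
noncomputable def decay (m κ x : ℝ) : ℝ :=
  max (sin x ^ 2 / (m - sin x * cos x)) (max (sin x) 0 / √(cos x ^ 2 + κ ^ 2))

/-- The costate of the angle along the extremals. -/
noncomputable def costate (m κ x : ℝ) : ℝ :=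
  max (sin x) 0 * (cos x + √(cos x ^ 2 + κ ^ 2)) +
    max (max (sin x) 0 * (cos x + √(cos x ^ 2 + κ ^ 2)) - m) 0 ^ 2 / (2 * (m - sin x * cos x))

/-- A weight that is `1` up to `c` and less than `1` after. -/
noncomputable def cutoff (c x : ℝ) : ℝ := (1 + max (x - c) 0)⁻¹

lemma continuous_speed (m κ : ℝ) : Continuous (speed m κ) := by
  unfold speed; fun_prop

/-- Writing the decay as a maximum, rather than as `sin x ^ 2 / speed m κ x`, is what keeps it
continuous at the poles, where the speed vanishes. -/
lemma continuous_decay {m κ : ℝ} (hm : 1 / 2 < m) (hκ : 0 < κ) : Continuous (decay m κ) := by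
  unfold decay
  exact ((by fun_prop : Continuous fun x => sin x ^ 2).div (by fun_prop)
    fun x => (saturated_speed_pos hm x).ne').max
    ((by fun_prop : Continuous fun x => max (sin x) 0).div (by fun_prop)
      fun x => (sqrt_cos_pos hκ x).ne')

lemma continuous_costate {m κ : ℝ} (hm : 1 / 2 < m) : Continuous (costate m κ) := by
  unfold costate
  exact (by fun_prop : Continuous fun x => max (sin x) 0 * (cos x + √(cos x ^ 2 + κ ^ 2))).add
    ((by fun_prop : Continuous fun x =>
      max (max (sin x) 0 * (cos x + √(cos x ^ 2 + κ ^ 2)) - m) 0 ^ 2).div (by fun_prop)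
      fun x => (mul_pos two_pos (saturated_speed_pos hm x)).ne')

lemma continuous_cutoff (c : ℝ) : Continuous (cutoff c) := by
  unfold cutoff
  exact Continuous.inv₀ (by fun_prop) fun x => by positivity

lemma cutoff_of_le {c x : ℝ} (h : x ≤ c) : cutoff c x = 1 := by
  simp [cutoff, max_eq_right (sub_nonpos.2 h)]

lemma cutoff_pos (c x : ℝ) : 0 < cutoff c x := by
  unfold cutoff; positivity

lemma cutoff_le_one (c x : ℝ) : cutoff c x ≤ 1 :=
  inv_le_one_of_one_le₀ (by linarith [le_max_right (x - c) 0])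

lemma cutoff_lt_one {c x : ℝ} (h : c < x) : cutoff c x < 1 :=
  inv_lt_one_of_one_lt₀ (by linarith [le_max_left (x - c) 0])

lemma speed_pos {m κ x : ℝ} (hm : 1 / 2 < m) (hκ : 0 < κ) (hx : 0 < sin x) : 0 < speed m κ x :=
  lt_min (saturated_speed_pos hm x) (mul_pos (lt_max_of_lt_left hx) (sqrt_cos_pos hκ x))

lemma speed_le (m κ x : ℝ) : speed m κ x ≤ m - sin x * cos x := min_le_left _ _

lemma min_regularLaw {m κ x : ℝ} (hx : 0 ≤ sin x) :
    min m (regularLaw κ x) = speed m κ x + sin x * cos x := by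
  rw [speed, regularLaw, max_eq_left hx, ← min_add_add_right]
  congr 1 <;> ring

lemma decay_eq {m κ x : ℝ} (hm : 1 / 2 < m) (hκ : 0 < κ) (hx : 0 < sin x) :
    decay m κ x = sin x ^ 2 * (1 / speed m κ x) := by
  have h1 := saturated_speed_pos hm x
  have h2 := sqrt_cos_pos hκ x
  rw [decay, speed, max_eq_left hx.le]
  rcases le_total (m - sin x * cos x) (sin x * √(cos x ^ 2 + κ ^ 2)) with h | h
  · rw [min_eq_left h, max_eq_left, mul_one_div]
    rw [div_le_div_iff₀ h2 h1]
    nlinarith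
  · rw [min_eq_right h, max_eq_right]
    · field_simp
    · rw [div_le_div_iff₀ h1 h2]
      nlinarith

lemma costate_of_nonpos {m κ x : ℝ} (hm : 1 / 2 < m) (hx : sin x ≤ 0) : costate m κ x = 0 := by
  have : max (0 - m) 0 = 0 := max_eq_right (by linarith)
  rw [costate, max_eq_right hx, zero_mul, this]
  simp

/-- The defect in the Hamilton-Jacobi inequality controls the deviation from the optimal law. -/
lemma sq_sub_min_regularLaw_le {m κ x u : ℝ} (hm : 1 / 2 < m) (hx : 0 ≤ sin x) (hu : u ≤ m) :
    (u - min m (regularLaw κ x)) ^ 2 / 2 ≤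
      u ^ 2 / 2 + κ ^ 2 / 2 * sin x ^ 2 - costate m κ x * (u - sin x * cos x) := by
  have hD := saturated_speed_pos hm x
  have hq := sq_sqrt_cos κ x
  -- The vanishing of the Hamiltonian when the costate equals the control.
  have hr : regularLaw κ x ^ 2 = 2 * regularLaw κ x * (sin x * cos x) + κ ^ 2 * sin x ^ 2 := by
    rw [regularLaw]
    linear_combination sin x ^ 2 * hq
  have hp : costate m κ x = regularLaw κ x +
      max (regularLaw κ x - m) 0 ^ 2 / (2 * (m - sin x * cos x)) := by
    rw [costate, max_eq_left hx, regularLaw]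
  generalize regularLaw κ x = r at *
  rw [hp]
  rcases le_total r m with h | h
  · rw [min_eq_right h, max_eq_right (by linarith)]
    simp only [ne_eq, OfNat.ofNat_ne_zero, not_false_eq_true, zero_pow, zero_div, add_zero]
    nlinarith
  · rw [min_eq_left h, max_eq_left (by linarith)]
    set D := m - sin x * cos x with hDdef
    have hs : sin x * cos x = m - D := by rw [hDdef]; ring
    rw [hs] at hr ⊢
    have h1 : 0 ≤ (m - u) * (r - m) := mul_nonneg (by linarith) (by linarith)
    have h2 : 0 ≤ (r - m) ^ 2 / (2 * D) * (m - u) := mul_nonneg (by positivity) (by linarith)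
    have h3 : (r - m) ^ 2 / (2 * D) * D = (r - m) ^ 2 / 2 := by field_simp
    have h4 : (r + (r - m) ^ 2 / (2 * D)) * (u - (m - D)) =
      r * (u - (m - D)) + (r - m) ^ 2 / 2 - (r - m) ^ 2 / (2 * D) * (m - u) := by
      rw [← h3]; ring
    rw [h4]
    nlinarith

/-- No sign of `sin x` is assumed: where it is not positive the costate vanishes. Calibration can
thus handle trajectories that leave `[0, θτ]`. -/
lemma costate_mul_le {m κ x u : ℝ} (hm : 1 / 2 < m) (hu : u ≤ m) :
    costate m κ x * (u - sin x * cos x) ≤ u ^ 2 / 2 + κ ^ 2 / 2 * sin x ^ 2 := by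
  rcases le_total 0 (sin x) with hx | hx
  · have := sq_sub_min_regularLaw_le (κ := κ) hm hx hu
    linarith [sq_nonneg (u - min m (regularLaw κ x))]
  · rw [costate_of_nonpos hm hx, zero_mul]
    positivity

/-- The equality case: the Hamiltonian vanishes along the optimal law. -/
lemma costate_mul_speed {m κ x : ℝ} (hm : 1 / 2 < m) (hx : 0 ≤ sin x) :
    costate m κ x * speed m κ x = min m (regularLaw κ x) ^ 2 / 2 + κ ^ 2 / 2 * sin x ^ 2 := by
  have hD := saturated_speed_pos hm x
  have hq := sq_sqrt_cos κ x
  have hr : regularLaw κ x ^ 2 = 2 * regularLaw κ x * (sin x * cos x) + κ ^ 2 * sin x ^ 2 := by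
    rw [regularLaw]
    linear_combination sin x ^ 2 * hq
  have hp : costate m κ x = regularLaw κ x +
      max (regularLaw κ x - m) 0 ^ 2 / (2 * (m - sin x * cos x)) := by
    rw [costate, max_eq_left hx, regularLaw]
  have hv := min_regularLaw (m := m) (κ := κ) hx
  have hv' : speed m κ x = min m (regularLaw κ x) - sin x * cos x := by linarith
  rw [hv', hp]
  generalize regularLaw κ x = r at *
  rcases le_total r m with h | h
  · rw [min_eq_right h, max_eq_right (by linarith)]
    simp only [ne_eq, OfNat.ofNat_ne_zero, not_false_eq_true, zero_pow, zero_div, add_zero]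
    linarith
  · rw [min_eq_left h, max_eq_left (by linarith)]
    have h3 : (r - m) ^ 2 / (2 * (m - sin x * cos x)) * (m - sin x * cos x) = (r - m) ^ 2 / 2 := by
      field_simp
    rw [add_mul, h3]
    linarith

lemma sin_pos_of_mem {θτ x : ℝ} (hτ : θτ = π / 2 ∨ θτ = π) (hx : x ∈ Ioo 0 θτ) : 0 < sin x := by
  have := pi_pos
  refine sin_pos_of_pos_of_lt_pi hx.1 (hx.2.trans_le ?_)
  rcases hτ with rfl | rfl <;> linarith

lemma target_pos {θτ : ℝ} (hτ : θτ = π / 2 ∨ θτ = π) : 0 < θτ := by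
  have := pi_pos
  rcases hτ with rfl | rfl <;> linarith

lemma target_le_pi {θτ : ℝ} (hτ : θτ = π / 2 ∨ θτ = π) : θτ ≤ π := by
  have := pi_pos
  rcases hτ with rfl | rfl <;> linarith

lemma sin_ne_zero_beyond {θτ x : ℝ} (hτ : θτ = π / 2 ∨ θτ = π) (hx : x ∈ Ioo θτ (θτ + π / 2)) :
    sin x ≠ 0 := by
  have := pi_pos
  rcases hτ with rfl | rfl
  · exact (sin_pos_of_pos_of_lt_pi (by linarith [hx.1]) (by linarith [hx.2])).ne'
  · have := sin_pos_of_pos_of_lt_pi (x := x - π) (by linarith [hx.1]) (by linarith [hx.2])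
    rw [sin_sub_pi] at this
    linarith

lemma sin_nonneg_of_mem {θτ x : ℝ} (hτ : θτ = π / 2 ∨ θτ = π) (hx : x ∈ Icc 0 θτ) : 0 ≤ sin x :=
  sin_nonneg_of_nonneg_of_le_pi hx.1 (hx.2.trans (target_le_pi hτ))

/-- The least energy for the parameter `κ`. -/
noncomputable def leastEnergy (m κ θτ : ℝ) : ℝ :=
  ∫ x in 0..θτ, (costate m κ x - κ ^ 2 / 2 * decay m κ x)

/-- The logarithm of the ratio of the radii under the law `min m (regularLaw κ)`. -/
noncomputable def totalDecay (m κ θτ : ℝ) : ℝ := ∫ x in 0..θτ, decay m κ x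

lemma continuous_cost {m κ : ℝ} (hm : 1 / 2 < m) (hκ : 0 < κ) :
    Continuous fun x => costate m κ x - κ ^ 2 / 2 * decay m κ x :=
  (continuous_costate hm).sub (continuous_const.mul (continuous_decay hm hκ))

/-- Energy per unit of angle under the optimal law, in the form delivered by `exists_transfer_Ioo`
for `w = 1 / speed m κ`. -/
lemma cost_eq {m κ x : ℝ} (hm : 1 / 2 < m) (hκ : 0 < κ) (hx : 0 < sin x) :
    costate m κ x - κ ^ 2 / 2 * decay m κ x =
      1 / speed m κ x * ((1 / (1 / speed m κ x) + sin x * cos x) ^ 2 / 2) := by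
  have hv := speed_pos hm hκ hx
  have h1 := costate_mul_speed (κ := κ) hm hx.le
  rw [min_regularLaw hx.le] at h1
  rw [one_div_one_div, decay_eq hm hκ hx]
  field_simp
  linarith

lemma lintegral_Ioo_ofReal {c : ℝ} (hc : 0 ≤ c) {g : ℝ → ℝ} (hg : Continuous g)
    (h0 : ∀ x ∈ Ioo 0 c, 0 ≤ g x) :
    ∫⁻ x in Ioo 0 c, ENNReal.ofReal (g x) = ENNReal.ofReal (∫ x in 0..c, g x) := by
  rw [intervalIntegral.integral_of_le hc, integral_Ioc_eq_integral_Ioo,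
    ofReal_integral_eq_lintegral_ofReal]
  · exact hg.integrableOn_Icc.mono_set Ioo_subset_Icc_self
  · filter_upwards [ae_restrict_mem measurableSet_Ioo] with x hx using h0 x hx

/-! ### Optimality of the law `min m (regularLaw κ)`. -/

section Optimality

variable {m κ θτ : ℝ}

lemma cost_nonneg (hm : 1 / 2 < m) (hκ : 0 < κ) (hτ : θτ = π / 2 ∨ θτ = π) :
    ∀ x ∈ Ioo 0 θτ, 0 ≤ costate m κ x - κ ^ 2 / 2 * decay m κ x := by
  intro x hx
  have hs := sin_pos_of_mem hτ hx
  rw [cost_eq hm hκ hs]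
  have := speed_pos hm hκ hs
  positivity

lemma leastEnergy_nonneg (hm : 1 / 2 < m) (hκ : 0 < κ) (hτ : θτ = π / 2 ∨ θτ = π) :
    0 ≤ leastEnergy m κ θτ := by
  rw [leastEnergy, intervalIntegral.integral_of_le (target_pos hτ).le, integral_Ioc_eq_integral_Ioo]
  exact setIntegral_nonneg measurableSet_Ioo (cost_nonneg hm hκ hτ)

/-- The energy of a transfer is at least `leastEnergy`, with equality only for the optimal law. -/
lemma leastEnergy_le (hm : 1 / 2 < m) (hκ : 0 < κ) (hτ : θτ = π / 2 ∨ θτ = π)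
    {I : Set ℝ} {u a θ : ℝ → ℝ} (h : IsTransfer m (exp (-totalDecay m κ θτ)) θτ I u a θ) :
    ENNReal.ofReal (leastEnergy m κ θτ) ≤ energy I u ∧
      (energy I u ≤ ENNReal.ofReal (leastEnergy m κ θτ) →
        Follows θτ (fun x => min m (regularLaw κ x)) I u θ) := by
  by_cases hfin : energy I u = ⊤
  · rw [hfin]
    exact ⟨le_top, fun h => absurd (top_le_iff.1 h) ENNReal.ofReal_ne_top⟩
  -- The weight does not change the potential difference between `0` and `θτ`, but makes the
  -- inequality strict beyond `θτ`, so that equality excludes overshooting.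
  set p : ℝ → ℝ := fun x => cutoff θτ x * costate m κ x with hpdef
  have hpc : Continuous p := (continuous_cutoff θτ).mul (continuous_costate hm)
  have hP : ∀ x, HasDerivAt (fun x => ∫ y in 0..x, p y) (p x) x := fun x =>
    (hpc.integral_hasStrictDerivAt 0 x).hasDerivAt
  have hτ0 := target_pos hτ
  have hval : (∫ y in 0..θτ, p y) - (∫ y in 0..(0 : ℝ), p y) +
      κ ^ 2 / 2 * log (exp (-totalDecay m κ θτ)) = leastEnergy m κ θτ := by
    rw [intervalIntegral.integral_same, log_exp, leastEnergy, intervalIntegral.integral_sub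
      ((continuous_costate hm).intervalIntegrable _ _)
      (((continuous_decay hm hκ).intervalIntegrable _ _).const_mul _),
      intervalIntegral.integral_const_mul, totalDecay,
      intervalIntegral.integral_congr (g := costate m κ)]
    · ring
    · intro x hx
      rw [uIcc_of_le hτ0.le] at hx
      simp only [hpdef]
      rw [cutoff_of_le hx.2, one_mul]
  have hle : ∀ x v, v ≤ m → p x * (v - sin x * cos x) ≤ cutoff θτ x *
      (v ^ 2 / 2 + κ ^ 2 / 2 * sin x ^ 2) := by
    intro x v hv
    rw [hpdef]
    simp only
    rw [mul_assoc]
    exact mul_le_mul_of_nonneg_left (costate_mul_le hm hv) (cutoff_pos _ _).le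
  have hnn : ∀ x v : ℝ, 0 ≤ v ^ 2 / 2 + κ ^ 2 / 2 * sin x ^ 2 := fun x v => by positivity
  obtain ⟨h1, h2⟩ := h.calibration hpc hP (c := 1) (l := κ ^ 2 / 2) (E := (energy I u).toReal) (by
      filter_upwards [ae_restrict_mem h.measurableSet] with t ht
      have hu := (abs_le.1 (h.bound t ht)).2
      refine (hle _ _ hu).trans ?_
      rw [one_mul]
      exact mul_le_of_le_one_left (hnn _ _) (cutoff_le_one _ _))
    (fun s hs t ht hst => h.integral_le_energy_toReal hfin hs ht hst)
  rw [hval] at h1 h2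
  refine ⟨(ENNReal.ofReal_le_iff_le_toReal hfin).2 h1, fun hE => ?_⟩
  have h3 := h2 (ENNReal.toReal_le_of_le_ofReal (leastEnergy_nonneg hm hκ hτ) hE)
  have hsin0 : ∀ x v : ℝ, v ^ 2 / 2 + κ ^ 2 / 2 * sin x ^ 2 = 0 → v = 0 ∧ sin x = 0 := by
    intro x v hv
    have ha : 0 ≤ κ ^ 2 / 2 * sin x ^ 2 := by positivity
    have hb : v ^ 2 = 0 := by nlinarith [sq_nonneg v]
    have hc : κ ^ 2 / 2 * sin x ^ 2 = 0 := by nlinarith [sq_nonneg v]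
    have hd : sin x ^ 2 = 0 := by
      rcases mul_eq_zero.1 hc with h' | h'
      · exact absurd h' (by positivity)
      · exact h'
    exact ⟨by simpa using hb, by simpa using hd⟩
  -- In either strip, equality would annihilate the running cost and thus `sin (θ t)`: below `0`
  -- because the costate vanishes, beyond `θτ` because the weight is less than `1`.
  have hmem : ∀ t ∈ I, θ t ∈ Icc 0 θτ := by
    refine h.angle_mem_Icc ?_
    filter_upwards [h3, ae_restrict_mem h.measurableSet] with t ht htI
    have hu := (abs_le.1 (h.bound t htI)).2
    rw [one_mul] at ht
    constructor
    · intro hx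
      have hs := sin_neg_of_neg_of_neg_pi_lt hx.2 hx.1
      rw [hpdef] at ht
      simp only at ht
      rw [costate_of_nonpos hm hs.le, mul_zero, zero_mul] at ht
      exact hs.ne (hsin0 _ _ ht.symm).2
    · intro hx
      have h4 := hle (θ t) (u t) hu
      have h5 := cutoff_lt_one hx.1
      have h6 := hnn (θ t) (u t)
      exact sin_ne_zero_beyond hτ hx (hsin0 _ (u t) (by nlinarith)).2
  refine ⟨hmem, ?_⟩
  filter_upwards [h3, ae_restrict_mem h.measurableSet] with t ht htI
  have hu := (abs_le.1 (h.bound t htI)).2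
  have hs := sin_nonneg_of_mem hτ (hmem t htI)
  have h4 := sq_sub_min_regularLaw_le (κ := κ) hm hs hu
  rw [hpdef] at ht
  simp only at ht
  rw [cutoff_of_le (hmem t htI).2, one_mul, one_mul] at ht
  have h5 : (u t - min m (regularLaw κ (θ t))) ^ 2 = 0 :=
    le_antisymm (by linarith) (sq_nonneg _)
  exact sub_eq_zero.1 (by simpa using h5)

/-- The speed vanishes to first order at the pole `0`, so leaving it takes infinite time; hence the
open range of angles. -/
lemma exists_transfer_leastEnergy (hm : 1 / 2 < m) (hκ : 0 < κ) (hτ : θτ = π / 2 ∨ θτ = π) :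
    ∃ (I : Set ℝ) (u a θ : ℝ → ℝ), IsTransfer m (exp (-totalDecay m κ θτ)) θτ I u a θ ∧
      energy I u = ENNReal.ofReal (leastEnergy m κ θτ) := by
  have hs : ∀ x ∈ Ioo 0 θτ, 0 < sin x := fun x hx => sin_pos_of_mem hτ hx
  have hv : ∀ x ∈ Ioo 0 θτ, 0 < speed m κ x := fun x hx => speed_pos hm hκ (hs x hx)
  obtain ⟨I, u, a, θ, h1, -, h3⟩ := exists_transfer_Ioo (m := m) (w := fun x => 1 / speed m κ x)
    (target_pos hτ)
    (continuousOn_const.div (continuous_speed m κ).continuousOn fun x hx => (hv x hx).ne')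
    (fun x hx => one_div_pos.2 (hv x hx))
    (fun x hx => by
      rw [one_div_one_div, abs_le]
      constructor
      · linarith [hv x hx, neg_le_sin_mul_cos x]
      · linarith [speed_le m κ x])
    (continuous_decay hm hκ) (fun x hx => decay_eq hm hκ (hs x hx))
  refine ⟨I, u, a, θ, h1, ?_⟩
  rw [h3, leastEnergy, ← lintegral_Ioo_ofReal (target_pos hτ).le (continuous_cost hm hκ)
    (cost_nonneg hm hκ hτ)]
  exact setLIntegral_congr_fun measurableSet_Ioo fun x hx => by
    simp only [cost_eq hm hκ (hs x hx)]

lemma integral_sin_sq_pos (hτ : θτ = π / 2 ∨ θτ = π) : 0 < ∫ x in 0..θτ, sin x ^ 2 :=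
  intervalIntegral.intervalIntegral_pos_of_pos_on
    ((by fun_prop : Continuous fun x => sin x ^ 2).intervalIntegrable _ _)
    (fun x hx => pow_pos (sin_pos_of_mem hτ hx) 2) (target_pos hτ)

/-- In terms of the reciprocal speed `w` the cost is `1 / (2 * w) + y + w * y ^ 2 / 2`: a gain of at
most `δ` in speed costs `δ / 2`, a delay `c` costs at most `c / 2`. -/
lemma transit_cost_le {W w w' y c δ : ℝ} (hW : 0 < W) (hw : 0 < w) (hWw : W = w' + c)
    (h1 : 1 / W ≤ 1 / w + δ) (h2 : w' ≤ w) (hy : y ^ 2 ≤ 1) (hc : 0 ≤ c) :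
    W * ((1 / W + y) ^ 2 / 2) ≤ w * ((1 / w + y) ^ 2 / 2) + (δ / 2 + c / 2) := by
  have e : ∀ z : ℝ, 0 < z → z * ((1 / z + y) ^ 2 / 2) = 1 / z / 2 + y + z * y ^ 2 / 2 := by
    intro z hz
    field_simp
    ring
  rw [e W hW, e w hw]
  have h3 : W * y ^ 2 ≤ (w + c) * y ^ 2 := by gcongr; linarith
  nlinarith [mul_le_mul_of_nonneg_left hy hc]

/-- The least energy is approximated on compact time intervals: bound the speed from below by `δ`
and compensate by slowing down uniformly. -/
lemma exists_transfer_Icc_energy_le (hm : 1 / 2 < m) (hκ : 0 < κ) (hτ : θτ = π / 2 ∨ θτ = π)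
    {ε : ℝ} (hε : 0 < ε) :
    ∃ (τ : ℝ) (u a θ : ℝ → ℝ), 0 < τ ∧
      IsTransfer m (exp (-totalDecay m κ θτ)) θτ (Icc 0 τ) u a θ ∧
      energy (Icc 0 τ) u ≤ ENNReal.ofReal (leastEnergy m κ θτ + ε) := by
  have hτ0 := target_pos hτ
  set S := ∫ x in 0..θτ, sin x ^ 2 with hS
  have hS0 : 0 < S := integral_sin_sq_pos hτ
  -- The total excess of energy is linear in `δ`; the bound `m - 1 / 2` keeps the raised speed
  -- admissible.
  obtain ⟨δ, hδ0, hδm, hδε⟩ : ∃ δ : ℝ, 0 < δ ∧ δ < m - 1 / 2 ∧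
      θτ * (δ / 2 + θτ * (δ / κ ^ 2) / S / 2) ≤ ε := by
    set C := θτ * (1 / 2 + θτ / κ ^ 2 / S / 2) with hC
    have hC0 : 0 < C := by positivity
    refine ⟨min ((m - 1 / 2) / 2) (ε / C), lt_min (by linarith) (by positivity),
      (min_le_left _ _).trans_lt (by linarith), ?_⟩
    calc _ = min ((m - 1 / 2) / 2) (ε / C) * C := by rw [hC]; ring
      _ ≤ ε / C * C := by gcongr; exact min_le_right _ _
      _ = ε := by field_simp
  set v : ℝ → ℝ := fun x => max (speed m κ x) δ with hv
  have hv0 : ∀ x, 0 < v x := fun x => lt_max_of_lt_right hδ0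
  have hvc : Continuous v := (continuous_speed m κ).max continuous_const
  have hvm : ∀ x, v x ≤ m - sin x * cos x := fun x =>
    max_le (speed_le _ _ _) (by linarith [sin_mul_cos_le x])
  have hwc : Continuous fun x => 1 / v x := continuous_const.div hvc fun x => (hv0 x).ne'
  have hsc : Continuous fun x => sin x ^ 2 * (1 / v x) :=
    (by fun_prop : Continuous fun x => sin x ^ 2).mul hwc
  set d : ℝ → ℝ := fun x => decay m κ x - sin x ^ 2 * (1 / v x) with hd
  have hdc : Continuous d := (continuous_decay hm hκ).sub hsc
  have hd0 : ∀ x ∈ Ioo 0 θτ, 0 ≤ d x := by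
    intro x hx
    have hs := sin_pos_of_mem hτ hx
    have := one_div_le_one_div_of_le (speed_pos hm hκ hs) (le_max_left (speed m κ x) δ)
    simp only [hd]
    rw [decay_eq hm hκ hs, ← mul_sub]
    exact mul_nonneg (sq_nonneg _) (sub_nonneg.2 this)
  -- The speed is raised only where `sin x * √(cos x ^ 2 + κ ^ 2) ≤ δ`; there the whole decay is at
  -- most `δ / (cos x ^ 2 + κ ^ 2)`.
  have hd1 : ∀ x ∈ Ioo 0 θτ, d x ≤ δ / κ ^ 2 := by
    intro x hx
    have hs := sin_pos_of_mem hτ hx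
    rcases le_total δ (speed m κ x) with h | h
    · simp only [hd, hv]
      rw [max_eq_left h, decay_eq hm hκ hs, sub_self]
      positivity
    · have hq := le_sqrt_cos κ x
      have hq0 := sqrt_cos_pos hκ x
      have hsat : δ < m - sin x * cos x := by linarith [sin_mul_cos_le x]
      have h1 : max (sin x) 0 * √(cos x ^ 2 + κ ^ 2) ≤ δ := (min_le_iff.1 h).resolve_left hsat.not_ge
      have h2 : speed m κ x = sin x * √(cos x ^ 2 + κ ^ 2) := by
        rw [speed, min_eq_right (h1.trans hsat.le), max_eq_left hs.le]
      rw [max_eq_left hs.le] at h1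
      have h3 : d x ≤ sin x / √(cos x ^ 2 + κ ^ 2) := by
        have h4 : 0 ≤ sin x ^ 2 * (1 / v x) := mul_nonneg (sq_nonneg _) (one_div_pos.2 (hv0 x)).le
        have h5 : decay m κ x = sin x / √(cos x ^ 2 + κ ^ 2) := by
          rw [decay_eq hm hκ hs, h2]
          field_simp
        simp only [hd]
        linarith
      refine h3.trans ?_
      rw [div_le_div_iff₀ hq0 (by positivity)]
      nlinarith [mul_le_mul_of_nonneg_left hq (mul_pos hs hκ).le,
        mul_le_mul_of_nonneg_right h1 hκ.le, mul_le_mul_of_nonneg_left hq hδ0.le]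
  set η := ∫ x in 0..θτ, d x with hη
  have hη0 : 0 ≤ η := by
    have := intervalIntegral.integral_mono_on_of_le_Ioo (μ := volume) (f := fun _ => (0 : ℝ)) hτ0.le
      intervalIntegrable_const (hdc.intervalIntegrable _ _) hd0
    simpa using this
  have hη1 : η ≤ θτ * (δ / κ ^ 2) := by
    have := intervalIntegral.integral_mono_on_of_le_Ioo (μ := volume) (g := fun _ => δ / κ ^ 2) hτ0.le
      (hdc.intervalIntegrable _ _) (continuous_const.intervalIntegrable _ _) hd1
    rwa [intervalIntegral.integral_const, smul_eq_mul, sub_zero] at this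
  -- The uniform delay `c` adds `c * S` to the decay, exactly the loss `η` due to the raised speed.
  set c := η / S with hc
  have hc0 : 0 ≤ c := by positivity
  set W : ℝ → ℝ := fun x => 1 / v x + c with hW
  have hW1 : ∀ x, 1 / v x ≤ W x := fun x => by simp only [hW]; linarith
  have hW0 : ∀ x, 0 < W x := fun x => (one_div_pos.2 (hv0 x)).trans_le (hW1 x)
  have hWv : ∀ x, 1 / W x ≤ v x := fun x => by
    have := one_div_le_one_div_of_le (one_div_pos.2 (hv0 x)) (hW1 x)
    rwa [one_div_one_div] at this
  obtain ⟨τ, u, a, θ, h1, h2, -, h3⟩ := exists_transfer_Icc (m := m) (w := W) hτ0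
    (hwc.add continuous_const) hW0 (fun x _ => by
      rw [abs_le]
      constructor
      · linarith [one_div_pos.2 (hW0 x), neg_le_sin_mul_cos x]
      · linarith [hWv x, hvm x])
  have hrad : ∫ x in 0..θτ, sin x ^ 2 * W x = totalDecay m κ θτ := by
    have e1 : ∫ x in 0..θτ, sin x ^ 2 * W x =
        ∫ x in 0..θτ, (decay m κ x - d x + c * sin x ^ 2) := by
      refine intervalIntegral.integral_congr fun x _ => ?_
      simp only [hW, hd]
      ring
    rw [e1, intervalIntegral.integral_add
      (((continuous_decay hm hκ).intervalIntegrable _ _).sub (hdc.intervalIntegrable _ _))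
      ((by fun_prop : Continuous fun x => c * sin x ^ 2).intervalIntegrable _ _),
      intervalIntegral.integral_sub ((continuous_decay hm hκ).intervalIntegrable _ _)
      (hdc.intervalIntegrable _ _), intervalIntegral.integral_const_mul, ← hS, ← hη, totalDecay, hc]
    field_simp
    ring
  rw [hrad] at h2
  refine ⟨τ, u, a, θ, h1, h2, ?_⟩
  have hcc := continuous_cost hm hκ
  rw [h3, setLIntegral_congr Ioo_ae_eq_Icc.symm]
  calc _ ≤ ∫⁻ x in Ioo 0 θτ, ENNReal.ofReal
        (costate m κ x - κ ^ 2 / 2 * decay m κ x + (δ / 2 + c / 2)) := by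
        refine setLIntegral_mono' measurableSet_Ioo fun x hx => ENNReal.ofReal_le_ofReal ?_
        have hs := sin_pos_of_mem hτ hx
        have hsp := speed_pos hm hκ hs
        rw [cost_eq hm hκ hs]
        refine transit_cost_le (hW0 x) (one_div_pos.2 hsp) rfl ?_
          (one_div_le_one_div_of_le hsp (le_max_left _ _)) ?_ hc0
        · rw [one_div_one_div]
          exact (hWv x).trans (max_le (by linarith) (by linarith))
        · nlinarith [sin_mul_cos_le x, neg_le_sin_mul_cos x]
    _ = ENNReal.ofReal (leastEnergy m κ θτ + θτ * (δ / 2 + c / 2)) := by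
        rw [lintegral_Ioo_ofReal hτ0.le (by fun_prop) fun x hx =>
          add_nonneg (cost_nonneg hm hκ hτ x hx) (by positivity),
          intervalIntegral.integral_add (hcc.intervalIntegrable _ _)
          (continuous_const.intervalIntegrable _ _), intervalIntegral.integral_const, leastEnergy]
        simp
    _ ≤ _ := by
        refine ENNReal.ofReal_le_ofReal ?_
        have : c ≤ θτ * (δ / κ ^ 2) / S := by rw [hc]; gcongr
        have : θτ * (δ / 2 + c / 2) ≤ θτ * (δ / 2 + θτ * (δ / κ ^ 2) / S / 2) := by gcongr
        linarith

theorem isMinimumEnergyFeedback_min (hm : 1 / 2 < m) (hκ : 0 < κ) (hτ : θτ = π / 2 ∨ θτ = π) :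
    IsMinimumEnergyFeedback m (exp (-totalDecay m κ θτ)) θτ
      (fun x => min m (regularLaw κ x)) := by
  obtain ⟨I₀, u₀, a₀, θ₀, h₀, he₀⟩ := exists_transfer_leastEnergy (m := m) (κ := κ) hm hκ hτ
  have hmin : ∀ I u a θ, IsMinimumEnergyTransfer m (exp (-totalDecay m κ θτ)) θτ I u a θ →
      energy I u = ENNReal.ofReal (leastEnergy m κ θτ) := fun I u a θ h =>
    le_antisymm (he₀ ▸ h.minimal _ _ _ _ h₀) (leastEnergy_le hm hκ hτ h.transfer).1
  refine ⟨⟨I₀, u₀, a₀, θ₀, ⟨h₀, he₀ ▸ ENNReal.ofReal_lt_top, fun I u a θ h => ?_⟩, ?_⟩, ?_, ?_⟩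
  · rw [he₀]
    exact (leastEnergy_le hm hκ hτ h).1
  · exact (leastEnergy_le hm hκ hτ h₀).2 he₀.le
  · exact fun I u a θ h => (leastEnergy_le hm hκ hτ h.transfer).2 (hmin I u a θ h).le
  · intro I u a θ h
    refine ⟨?_, fun b hb => ?_⟩
    · rintro E ⟨τ, u', a', θ', -, h', rfl⟩
      exact h.minimal _ _ _ _ h'
    · rw [hmin I u a θ h]
      refine ENNReal.le_of_forall_pos_le_add fun ε hε _ => ?_
      obtain ⟨τ, u', a', θ', hτ', h', he'⟩ :=
        exists_transfer_Icc_energy_le (m := m) (κ := κ) hm hκ hτ (NNReal.coe_pos.2 hε)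
      refine (hb ⟨τ, u', a', θ', hτ', h', rfl⟩).trans (he'.trans ?_)
      rw [ENNReal.ofReal_add (leastEnergy_nonneg hm hκ hτ) ε.coe_nonneg, ENNReal.ofReal_coe_nnreal]

end Optimality

lemma IsMinimumEnergyFeedback.congr {m rτ θτ : ℝ} {U V : ℝ → ℝ}
    (h : IsMinimumEnergyFeedback m rτ θτ U) (hUV : EqOn U V (Icc 0 θτ)) :
    IsMinimumEnergyFeedback m rτ θτ V := by
  have key : ∀ (I : Set ℝ) (u a θ : ℝ → ℝ), IsTransfer m rτ θτ I u a θ → Follows θτ U I u θ →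
      Follows θτ V I u θ := by
    intro I u a θ ht hf
    refine ⟨hf.1, ?_⟩
    filter_upwards [hf.2, ae_restrict_mem ht.measurableSet] with t h1 h2
    rw [h1, hUV (hf.1 t h2)]
  obtain ⟨I, u, a, θ, h1, h2⟩ := h.exists_minimizer
  exact ⟨⟨I, u, a, θ, h1, key _ _ _ _ h1.transfer h2⟩,
    fun I u a θ h' => key _ _ _ _ h'.transfer (h.follows I u a θ h'), h.isGLB_finite_duration⟩

/-- Two minimum-energy feedback laws agree somewhere in each range of angles. -/
lemma IsMinimumEnergyFeedback.exists_eq {m rτ θτ y₁ y₂ : ℝ} {U V : ℝ → ℝ}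
    (hU : IsMinimumEnergyFeedback m rτ θτ U) (hV : IsMinimumEnergyFeedback m rτ θτ V)
    (h0 : 0 < y₁) (hy : y₁ < y₂) (hτ : y₂ < θτ) : ∃ x ∈ Ioo y₁ y₂, U x = V x := by
  obtain ⟨I, u, a, θ, h1, h2⟩ := hU.exists_minimizer
  have h3 := hV.follows I u a θ h1
  obtain ⟨t, -, ht, h4, h5⟩ := h1.transfer.exists_mem_Ioo_of_ae h0 hy hτ (h2.2.and h3.2)
  exact ⟨θ t, ht, h4.symm.trans h5⟩


/-! ### The control `u = m` and the largest reachable radius. -/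

/-- The logarithm of the ratio of the radii under `u = m`. -/
noncomputable def saturatedDecay (m θτ : ℝ) : ℝ :=
  ∫ x in 0..θτ, sin x ^ 2 / (m - sin x * cos x)

lemma continuous_saturatedDecay_integrand {m : ℝ} (hm : 1 / 2 < m) :
    Continuous fun x => sin x ^ 2 / (m - sin x * cos x) :=
  (by fun_prop : Continuous fun x => sin x ^ 2).div (by fun_prop)
    fun x => (saturated_speed_pos hm x).ne'

/-- While the angle is constant the control compensates the drift. -/
lemma IsTransfer.ae_control_eq {m rτ θτ : ℝ} {I : Set ℝ} {u a θ : ℝ → ℝ}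
    (h : IsTransfer m rτ θτ I u a θ) (c : ℝ) :
    ∀ᵐ t ∂volume.restrict I, θ t = c → u t = sin c * cos c := by
  refine ae_restrict_of_ae_restrict_inter_Ioo fun s t hs ht hst => ?_
  have h1 := h.ae_hasDerivAt_angle hs ht
  -- Only countably many points of the level set are isolated from the right; at the others the
  -- derivative can be computed along the level set, where the slopes are `0`.
  have h2 : ∀ᵐ x : ℝ, x ∉ {x ∈ {x | θ x = c} | 𝓝[{x | θ x = c} ∩ Ioi x] x = ⊥} :=
    countable_setOfPred_isolated_right_within.ae_notMem _
  rw [ae_restrict_iff' (h.measurableSet.inter measurableSet_Ioo)]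
  filter_upwards [h1, h2] with x hx1 hx2 hxI hxc
  have hne : (𝓝[{x | θ x = c} ∩ Ioi x] x).NeBot := ⟨fun hbot => hx2 ⟨hxc, hbot⟩⟩
  have hd := (hasDerivWithinAt_iff_tendsto_slope' (s := {x | θ x = c} ∩ Ioi x)
    (fun hx => lt_irrefl x hx.2)).1 (hx1 hxI.2).hasDerivWithinAt
  have hz : Tendsto (slope θ x) (𝓝[{x | θ x = c} ∩ Ioi x] x) (𝓝 0) := by
    refine tendsto_const_nhds.congr' ?_
    filter_upwards [self_mem_nhdsWithin] with y hy
    have hy1 : θ y = c := hy.1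
    rw [slope_def_field, hy1, hxc, sub_self, zero_div]
  have := tendsto_nhds_unique hd hz
  rw [hxc] at this
  linarith

section Saturated

variable {m θτ : ℝ}

/-- The radius is at most that under `u = m`, which is attained only by that control. -/
lemma saturated_bound (hm : 1 / 2 < m) (hτ : θτ = π / 2 ∨ θτ = π) {rτ : ℝ} (hr : 0 < rτ)
    {I : Set ℝ} {u a θ : ℝ → ℝ} (h : IsTransfer m rτ θτ I u a θ) :
    rτ ≤ exp (-saturatedDecay m θτ) ∧
      (rτ = exp (-saturatedDecay m θτ) → Follows θτ (saturatedLaw m) I u θ) := by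
  have hτ0 := target_pos hτ
  -- On `[0, θτ]` this is the decay per unit of angle at full speed. The positive part and the
  -- weight make the inequality strict in the two adjacent strips.
  set p : ℝ → ℝ := fun x => cutoff θτ x * (max (sin x) 0 ^ 2 / (m - sin x * cos x)) with hpdef
  have hpc : Continuous p := (continuous_cutoff θτ).mul
    ((by fun_prop : Continuous fun x => max (sin x) 0 ^ 2).div (by fun_prop)
      fun x => (saturated_speed_pos hm x).ne')
  have hP : ∀ x, HasDerivAt (fun x => ∫ y in 0..x, p y) (p x) x := fun x =>
    (hpc.integral_hasStrictDerivAt 0 x).hasDerivAt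
  have hval : (∫ y in 0..θτ, p y) = saturatedDecay m θτ := by
    rw [saturatedDecay]
    refine intervalIntegral.integral_congr fun x hx => ?_
    rw [uIcc_of_le hτ0.le] at hx
    simp only [hpdef]
    rw [cutoff_of_le hx.2, one_mul, max_eq_left (sin_nonneg_of_mem hτ hx)]
  have hle : ∀ x v, v ≤ m → p x * (v - sin x * cos x) ≤ cutoff θτ x * max (sin x) 0 ^ 2 := by
    intro x v hv
    have hD := saturated_speed_pos hm x
    simp only [hpdef]
    rw [mul_assoc]
    refine mul_le_mul_of_nonneg_left ?_ (cutoff_pos _ _).le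
    rw [div_mul_eq_mul_div, div_le_iff₀ hD]
    exact mul_le_mul_of_nonneg_left (by linarith) (sq_nonneg _)
  have hmax : ∀ x, max (sin x) 0 ^ 2 ≤ sin x ^ 2 := by
    intro x
    rcases le_total (sin x) 0 with hx | hx
    · rw [max_eq_right hx]; nlinarith [sq_nonneg (sin x)]
    · rw [max_eq_left hx]
  -- The energy is dropped: what is bounded below is the integral of `sin θ ^ 2`, that is `-log rτ`.
  obtain ⟨h1, h2⟩ := h.calibration hpc hP (c := 0) (l := 1) (E := 0) (by
      filter_upwards [ae_restrict_mem h.measurableSet] with t ht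
      refine (hle _ _ (abs_le.1 (h.bound t ht)).2).trans ?_
      rw [zero_mul, zero_add, one_mul]
      exact (mul_le_of_le_one_left (sq_nonneg _) (cutoff_le_one _ _)).trans (hmax _))
    (fun s hs t ht hst => by simp)
  rw [hval, intervalIntegral.integral_same] at h1 h2
  refine ⟨by rw [← exp_log hr]; exact exp_le_exp.2 (by linarith), fun hE => ?_⟩
  have h3 := h2 (by rw [hE, log_exp]; linarith)
  have hmem : ∀ t ∈ I, θ t ∈ Icc 0 θτ := by
    refine h.angle_mem_Icc ?_
    filter_upwards [h3, ae_restrict_mem h.measurableSet] with t ht htI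
    have hu := (abs_le.1 (h.bound t htI)).2
    have h4 := hle (θ t) (u t) hu
    rw [zero_mul, zero_add, one_mul] at ht
    rw [ht] at h4
    constructor
    · intro hx
      have hs := sin_neg_of_neg_of_neg_pi_lt hx.2 hx.1
      rw [max_eq_right hs.le] at h4
      nlinarith
    · intro hx
      have h5 := cutoff_lt_one hx.1
      have h6 := sq_pos_of_ne_zero (sin_ne_zero_beyond hτ hx)
      have h7 := mul_le_mul_of_nonneg_left (hmax (θ t)) (cutoff_pos θτ (θ t)).le
      nlinarith
  refine ⟨hmem, ?_⟩
  filter_upwards [h3, h.ae_control_eq 0, h.ae_control_eq π,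
    ae_restrict_mem h.measurableSet] with t ht ht0 htπ htI
  have hb := hmem t htI
  have hbπ := hb.2.trans (target_le_pi hτ)
  rw [saturatedLaw]
  split_ifs with hcond
  · have hs := sin_pos_of_pos_of_lt_pi hcond.1 hcond.2
    have hD := saturated_speed_pos hm (θ t)
    simp only [hpdef] at ht
    rw [cutoff_of_le hb.2, max_eq_left hs.le, one_mul, zero_mul, zero_add, one_mul,
      div_mul_eq_mul_div, div_eq_iff hD.ne'] at ht
    have := mul_left_cancel₀ (pow_pos hs 2).ne' ht
    linarith
  · rcases hb.1.eq_or_lt with h0 | h0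
    · simpa using ht0 h0.symm
    · rcases hbπ.eq_or_lt with h0' | h0'
      · simpa using htπ h0'
      · exact absurd ⟨h0, h0'⟩ hcond

theorem isMinimumEnergyFeedback_saturatedLaw (hm : 1 / 2 < m) (hτ : θτ = π / 2 ∨ θτ = π) :
    IsMinimumEnergyFeedback m (exp (-saturatedDecay m θτ)) θτ (saturatedLaw m) := by
  have hτ0 := target_pos hτ
  have hD := saturated_speed_pos hm
  -- Energy per unit of angle under `u = m`. At this radius all transfers follow the same law, so
  -- the comparison is needed only along that law, where it is an equality.
  set p : ℝ → ℝ := fun x => m ^ 2 / (2 * (m - sin x * cos x)) with hpdef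
  have hpc : Continuous p := continuous_const.div (by fun_prop) fun x => by
    have := hD x; positivity
  have hP : ∀ x, HasDerivAt (fun x => ∫ y in 0..x, p y) (p x) x := fun x =>
    (hpc.integral_hasStrictDerivAt 0 x).hasDerivAt
  have hp0 : ∀ x, 0 ≤ p x := fun x => by have := hD x; positivity
  have hfol : ∀ I u a θ, IsTransfer m (exp (-saturatedDecay m θτ)) θτ I u a θ →
      Follows θτ (saturatedLaw m) I u θ := fun I u a θ h =>
    (saturated_bound hm hτ (exp_pos _) h).2 rfl
  have hlow : ∀ I u a θ, IsTransfer m (exp (-saturatedDecay m θτ)) θτ I u a θ →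
      ENNReal.ofReal (∫ y in 0..θτ, p y) ≤ energy I u := by
    intro I u a θ h
    by_cases hfin : energy I u = ⊤
    · rw [hfin]; exact le_top
    have hf := hfol I u a θ h
    have h1 := (h.calibration hpc hP (c := 1) (l := 0) (E := (energy I u).toReal) (by
      filter_upwards [hf.2, ae_restrict_mem h.measurableSet] with t ht htI
      have hb := hf.1 t htI
      have hDt := hD (θ t)
      rw [ht, saturatedLaw]
      split_ifs with hcond
      · simp only [hpdef]
        apply le_of_eq
        field_simp
        ring
      · have hs : sin (θ t) = 0 := by
          rcases hb.1.eq_or_lt with h0 | h0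
          · rw [← h0, sin_zero]
          · rcases (hb.2.trans (target_le_pi hτ)).eq_or_lt with h0' | h0'
            · rw [h0', sin_pi]
            · exact absurd ⟨h0, h0'⟩ hcond
        rw [hs]
        simp)
      (fun s hs t ht hst => h.integral_le_energy_toReal hfin hs ht hst)).1
    rw [intervalIntegral.integral_same, sub_zero, zero_mul, add_zero] at h1
    exact (ENNReal.ofReal_le_iff_le_toReal hfin).2 h1
  have hwc : Continuous fun x => 1 / (m - sin x * cos x) :=
    continuous_const.div (by fun_prop) fun x => (hD x).ne'
  -- The speed under `u = m` is bounded away from `0`, so the minimum is attained in finite time.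
  obtain ⟨τ, u, a, θ, h1, h2, -, h3⟩ := exists_transfer_Icc (m := m) hτ0 hwc
    (fun x => one_div_pos.2 (hD x)) (fun x _ => by
      rw [one_div_one_div, sub_add_cancel, abs_of_pos (by linarith)])
  have hrad : ∫ x in 0..θτ, sin x ^ 2 * (1 / (m - sin x * cos x)) = saturatedDecay m θτ := by
    simp only [mul_one_div, saturatedDecay]
  rw [hrad] at h2
  have hen : energy (Icc 0 τ) u = ENNReal.ofReal (∫ y in 0..θτ, p y) := by
    rw [h3, setLIntegral_congr Ioo_ae_eq_Icc.symm, ← lintegral_Ioo_ofReal hτ0.le hpc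
      fun x _ => hp0 x]
    refine setLIntegral_congr_fun measurableSet_Ioo fun x hx => ?_
    have := hD x
    simp only [hpdef, one_div_one_div, sub_add_cancel]
    congr 1
    field_simp
  refine ⟨⟨Icc 0 τ, u, a, θ, ⟨h2, hen ▸ ENNReal.ofReal_lt_top, fun I' u' a' θ' h' => ?_⟩,
    hfol _ _ _ _ h2⟩, fun I' u' a' θ' h' => hfol _ _ _ _ h'.transfer, fun I' u' a' θ' h' => ⟨?_, ?_⟩⟩
  · rw [hen]; exact hlow _ _ _ _ h'
  · rintro E ⟨τ', u'', a'', θ'', -, h'', rfl⟩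
    exact h'.minimal _ _ _ _ h''
  · intro b hb
    refine (hb ⟨τ, u, a, θ, h1, h2, rfl⟩).trans ?_
    rw [hen]
    exact hlow _ _ _ _ h'.transfer

end Saturated

/-! ### Dependence of the final radius on `κ`. -/

section Decay

variable {m θτ : ℝ}

/-- The regular law tends to `0` at the pole. This unsaturated range makes the comparisons of decays
strict. -/
lemma exists_unsaturated (hm : 1 / 2 < m) (hτ : 0 < θτ) (κ : ℝ) :
    ∃ y ∈ Ioo 0 θτ, ∀ x ∈ Ioo 0 y, sin x * √(cos x ^ 2 + κ ^ 2) < m - sin x * cos x := by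
  have h1 : ∀ᶠ x in 𝓝 (0 : ℝ), sin x * √(cos x ^ 2 + κ ^ 2) < m - sin x * cos x := by
    have hc1 : ContinuousAt (fun x => sin x * √(cos x ^ 2 + κ ^ 2)) 0 := by fun_prop
    have hc2 : ContinuousAt (fun x => m - sin x * cos x) 0 := by fun_prop
    exact hc1.eventually_lt hc2 (by simp; linarith)
  obtain ⟨ε, hε, h2⟩ := Metric.eventually_nhds_iff.1 h1
  refine ⟨min (ε / 2) (θτ / 2), ⟨by positivity, (min_le_right _ _).trans_lt (by linarith)⟩,
    fun x hx => h2 ?_⟩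
  rw [dist_zero_right, norm_of_nonneg hx.1.le]
  exact (hx.2.trans_le (min_le_left _ _)).trans (by linarith)

lemma saturatedDecay_lt_totalDecay (hm : 1 / 2 < m) {κ : ℝ} (hκ : 0 < κ)
    (hτ : θτ = π / 2 ∨ θτ = π) : saturatedDecay m θτ < totalDecay m κ θτ := by
  have hτ0 := target_pos hτ
  obtain ⟨y, hy, h⟩ := exists_unsaturated hm hτ0 κ
  have hy2 : y / 2 ∈ Ioo 0 y := ⟨by linarith [hy.1], by linarith [hy.1]⟩
  have hs := sin_pos_of_mem hτ (x := y / 2) ⟨hy2.1, hy2.2.trans hy.2⟩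
  refine intervalIntegral.integral_lt_integral_of_continuousOn_of_le_of_exists_lt hτ0
    (continuous_saturatedDecay_integrand hm).continuousOn (continuous_decay hm hκ).continuousOn
    (fun x _ => le_max_left _ _) ⟨y / 2, ⟨hy2.1.le, (hy2.2.trans hy.2).le⟩, ?_⟩
  refine lt_max_of_lt_right ?_
  rw [max_eq_left hs.le, div_lt_div_iff₀ (saturated_speed_pos hm _) (sqrt_cos_pos hκ _)]
  nlinarith [h _ hy2]

lemma totalDecay_lt_of_lt (hm : 1 / 2 < m) {κ κ' : ℝ} (hκ : 0 < κ) (hκκ' : κ < κ')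
    (hτ : θτ = π / 2 ∨ θτ = π) : totalDecay m κ' θτ < totalDecay m κ θτ := by
  have hτ0 := target_pos hτ
  have hκ' := hκ.trans hκκ'
  have hq : ∀ x, √(cos x ^ 2 + κ ^ 2) < √(cos x ^ 2 + κ' ^ 2) := fun x =>
    sqrt_lt_sqrt (by positivity) (by nlinarith)
  obtain ⟨y, hy, h⟩ := exists_unsaturated hm hτ0 κ
  have hy2 : y / 2 ∈ Ioo 0 y := ⟨by linarith [hy.1], by linarith [hy.1]⟩
  have hs := sin_pos_of_mem hτ (x := y / 2) ⟨hy2.1, hy2.2.trans hy.2⟩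
  refine intervalIntegral.integral_lt_integral_of_continuousOn_of_le_of_exists_lt hτ0
    (continuous_decay hm hκ').continuousOn (continuous_decay hm hκ).continuousOn
    (fun x _ => max_le_max le_rfl ?_) ⟨y / 2, ⟨hy2.1.le, (hy2.2.trans hy.2).le⟩, ?_⟩
  · exact div_le_div_of_nonneg_left (le_max_right _ _) (sqrt_cos_pos hκ x) (hq x).le
  · refine max_lt (lt_max_of_lt_right ?_) (lt_max_of_lt_right ?_)
    · rw [max_eq_left hs.le, div_lt_div_iff₀ (saturated_speed_pos hm _) (sqrt_cos_pos hκ _)]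
      nlinarith [h _ hy2]
    · rw [max_eq_left hs.le]
      exact div_lt_div_of_pos_left hs (sqrt_cos_pos hκ _) (hq _)

lemma totalDecay_lt_iff (hm : 1 / 2 < m) {κ κ' : ℝ} (hκ : 0 < κ) (hκ' : 0 < κ')
    (hτ : θτ = π / 2 ∨ θτ = π) : totalDecay m κ' θτ < totalDecay m κ θτ ↔ κ < κ' := by
  refine ⟨fun h => ?_, fun h => totalDecay_lt_of_lt hm hκ h hτ⟩
  by_contra! hle
  rcases hle.eq_or_lt with rfl | hlt
  · exact lt_irrefl _ h
  · exact lt_asymm h (totalDecay_lt_of_lt hm hκ' hlt hτ)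

lemma totalDecay_inj (hm : 1 / 2 < m) {κ κ' : ℝ} (hκ : 0 < κ) (hκ' : 0 < κ')
    (hτ : θτ = π / 2 ∨ θτ = π) (h : totalDecay m κ θτ = totalDecay m κ' θτ) : κ = κ' := by
  rcases lt_trichotomy κ κ' with h' | h' | h'
  · exact absurd h (totalDecay_lt_of_lt hm hκ h' hτ).ne'
  · exact h'
  · exact absurd h (totalDecay_lt_of_lt hm hκ' h' hτ).ne

/-- A maximum of nonnegative terms is at most their sum. This controls the limit `κ → ∞`. -/
lemma totalDecay_le (hm : 1 / 2 < m) {κ : ℝ} (hκ : 0 < κ) (hτ : θτ = π / 2 ∨ θτ = π) :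
    totalDecay m κ θτ ≤ saturatedDecay m θτ + θτ / κ := by
  have hτ0 := target_pos hτ
  have hc := continuous_saturatedDecay_integrand hm
  have h : totalDecay m κ θτ ≤ ∫ x in 0..θτ, (sin x ^ 2 / (m - sin x * cos x) + 1 / κ) := by
    refine intervalIntegral.integral_mono_on hτ0.le ((continuous_decay hm hκ).intervalIntegrable _ _)
      ((hc.add continuous_const).intervalIntegrable _ _) fun x _ => ?_
    have h1 : 0 ≤ sin x ^ 2 / (m - sin x * cos x) :=
      div_nonneg (sq_nonneg _) (saturated_speed_pos hm x).le
    have h2 : max (sin x) 0 / √(cos x ^ 2 + κ ^ 2) ≤ 1 / κ :=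
      div_le_div₀ zero_le_one (max_le (sin_le_one x) zero_le_one) hκ (le_sqrt_cos κ x)
    have h3 : 0 < 1 / κ := by positivity
    exact max_le (by linarith) (by linarith)
  rwa [intervalIntegral.integral_add (hc.intervalIntegrable _ _) intervalIntegrable_const,
    intervalIntegral.integral_const, smul_eq_mul, sub_zero, mul_one_div] at h

/-- With `κ = exp y` the parameter ranges over all of `ℝ`, ready for the intermediate value theorem.
-/
lemma continuous_totalDecay_exp (hm : 1 / 2 < m) (θτ : ℝ) :
    Continuous fun y => totalDecay m (exp y) θτ := by
  refine intervalIntegral.continuous_parametric_intervalIntegral_of_continuous' ?_ 0 θτ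
  unfold Function.uncurry decay
  exact ((by fun_prop : Continuous fun z : ℝ × ℝ => sin z.2 ^ 2).div (by fun_prop)
    fun z => (saturated_speed_pos hm z.2).ne').max
    ((by fun_prop : Continuous fun z : ℝ × ℝ => max (sin z.2) 0).div (by fun_prop)
      fun z => (sqrt_cos_pos (exp_pos z.1) z.2).ne')

lemma hasDerivAt_log_cos_add_sqrt {κ : ℝ} (hκ : 0 < κ) (x : ℝ) :
    HasDerivAt (fun x => log (cos x + √(cos x ^ 2 + κ ^ 2))) (-(sin x / √(cos x ^ 2 + κ ^ 2))) x := by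
  have hq := sqrt_cos_pos hκ x
  have hp := cos_add_sqrt_pos hκ x
  have h1 : HasDerivAt (fun x => cos x ^ 2 + κ ^ 2) (2 * cos x * (-sin x)) x := by
    have := ((hasDerivAt_cos x).pow 2).add_const (κ ^ 2)
    simpa using this
  have h2 : HasDerivAt (fun x => cos x + √(cos x ^ 2 + κ ^ 2))
      (-sin x + 2 * cos x * (-sin x) / (2 * √(cos x ^ 2 + κ ^ 2))) x :=
    (hasDerivAt_cos x).add (h1.sqrt (by positivity))
  convert h2.log hp.ne' using 1
  field_simp
  ring

lemma integral_regular {κ : ℝ} (hκ : 0 < κ) (α β : ℝ) :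
    exp (-∫ x in α..β, sin x / √(cos x ^ 2 + κ ^ 2)) = regularRatio κ α β := by
  have hc : Continuous fun x => sin x / √(cos x ^ 2 + κ ^ 2) :=
    continuous_sin.div (by fun_prop) fun x => (sqrt_cos_pos hκ x).ne'
  have hα := cos_add_sqrt_pos hκ α
  have hβ := cos_add_sqrt_pos hκ β
  rw [← intervalIntegral.integral_neg, intervalIntegral.integral_eq_sub_of_hasDerivAt
    (fun x _ => hasDerivAt_log_cos_add_sqrt hκ x) (hc.neg.intervalIntegrable _ _), regularRatio,
    exp_sub, exp_log hα, exp_log hβ]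

lemma exp_neg_totalDecay_le (hm : 1 / 2 < m) {κ : ℝ} (hκ : 0 < κ) (hτ : θτ = π / 2 ∨ θτ = π) :
    exp (-totalDecay m κ θτ) ≤ regularRatio κ 0 θτ := by
  rw [← integral_regular hκ, exp_le_exp, neg_le_neg_iff]
  have hc : Continuous fun x => sin x / √(cos x ^ 2 + κ ^ 2) :=
    continuous_sin.div (by fun_prop) fun x => (sqrt_cos_pos hκ x).ne'
  refine intervalIntegral.integral_mono_on (target_pos hτ).le (hc.intervalIntegrable _ _)
    ((continuous_decay hm hκ).intervalIntegrable _ _) fun x hx => ?_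
  refine le_max_of_le_right ?_
  rw [max_eq_left (sin_nonneg_of_mem hτ hx)]

/-- At `κ = 0` the numerator is `cos θτ + |cos θτ|`, which vanishes because `cos θτ ≤ 0`;
arbitrarily small radii are therefore reached. -/
lemma tendsto_regularRatio_exp (hτ : θτ = π / 2 ∨ θτ = π) :
    Tendsto (fun y => regularRatio (exp y) 0 θτ) atBot (𝓝 0) := by
  have hc : ContinuousAt (fun κ => regularRatio κ 0 θτ) 0 := by
    unfold regularRatio
    refine ContinuousAt.div (by fun_prop) (by fun_prop) ?_
    simp
  have h0 : regularRatio 0 0 θτ = 0 := by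
    rcases hτ with rfl | rfl <;> simp [regularRatio]
  rw [ContinuousAt, h0] at hc
  exact hc.comp tendsto_exp_atBot

lemma exists_totalDecay_eq (hm : 1 / 2 < m) (hτ : θτ = π / 2 ∨ θτ = π) {rτ : ℝ} (hr : 0 < rτ)
    (hlt : rτ < exp (-saturatedDecay m θτ)) : ∃ κ, 0 < κ ∧ exp (-totalDecay m κ θτ) = rτ := by
  have hc : Continuous fun y => exp (-totalDecay m (exp y) θτ) :=
    continuous_exp.comp (continuous_totalDecay_exp hm θτ).neg
  obtain ⟨y₁, h1⟩ : ∃ y, exp (-totalDecay m (exp y) θτ) ≤ rτ := by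
    obtain ⟨y, hy⟩ := ((tendsto_regularRatio_exp hτ).eventually_lt_const hr).exists
    exact ⟨y, (exp_neg_totalDecay_le hm (exp_pos y) hτ).trans hy.le⟩
  obtain ⟨y₂, h2⟩ : ∃ y, rτ ≤ exp (-totalDecay m (exp y) θτ) := by
    have hlog : log rτ < -saturatedDecay m θτ := (log_lt_iff_lt_exp hr).2 hlt
    have hlim : Tendsto (fun y => θτ / exp y) atTop (𝓝 0) :=
      tendsto_const_nhds.div_atTop tendsto_exp_atTop
    obtain ⟨y, hy⟩ := (hlim.eventually_lt_const
      (show 0 < -saturatedDecay m θτ - log rτ by linarith)).exists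
    refine ⟨y, ?_⟩
    rw [← log_le_iff_le_exp hr]
    linarith [totalDecay_le hm (exp_pos y) hτ]
  obtain ⟨y, hy⟩ := mem_range_of_exists_le_of_exists_ge hc ⟨y₁, h1⟩ ⟨y₂, h2⟩
  exact ⟨exp y, exp_pos y, hy⟩

end Decay


/-! ### The cotangent and its inverse on `(0, π)`. -/

section Cotangent

lemma hasDerivAt_cot {x : ℝ} (hx : sin x ≠ 0) : HasDerivAt cot (-(1 / sin x ^ 2)) x := by
  have h : (cot : ℝ → ℝ) = fun x => cos x / sin x := funext cot_eq_cos_div_sin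
  have h1 : HasDerivAt (fun x => cos x / sin x)
      ((-sin x * sin x - cos x * cos x) / sin x ^ 2) x :=
    (hasDerivAt_cos x).div (hasDerivAt_sin x) hx
  have h2 : -(1 / sin x ^ 2) = (-sin x * sin x - cos x * cos x) / sin x ^ 2 := by
    rw [← neg_div]
    congr 1
    linarith [sin_sq_add_cos_sq x]
  rw [h, h2]
  exact h1

lemma cot_sub_cot {x y : ℝ} (hx : sin x ≠ 0) (hy : sin y ≠ 0) :
    cot x - cot y = sin (y - x) / (sin x * sin y) := by
  rw [cot_eq_cos_div_sin, cot_eq_cos_div_sin, sin_sub]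
  field_simp

lemma cot_lt_cot {x y : ℝ} (hx : 0 < x) (hxy : x < y) (hy : y < π) : cot y < cot x := by
  have h1 := sin_pos_of_pos_of_lt_pi hx (hxy.trans hy)
  have h2 := sin_pos_of_pos_of_lt_pi (hx.trans hxy) hy
  have h3 := sin_pos_of_pos_of_lt_pi (sub_pos.2 hxy) (by linarith)
  have : 0 < cot x - cot y := by
    rw [cot_sub_cot h1.ne' h2.ne']
    positivity
  linarith

lemma cot_lt_cot_iff {x y : ℝ} (hx : x ∈ Ioo 0 π) (hy : y ∈ Ioo 0 π) : cot y < cot x ↔ x < y := by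
  refine ⟨fun h => ?_, fun h => cot_lt_cot hx.1 h hy.2⟩
  by_contra! hle
  rcases hle.eq_or_lt with rfl | hlt
  · exact lt_irrefl _ h
  · exact lt_asymm h (cot_lt_cot hy.1 hlt hx.2)

lemma cot_inj {x y : ℝ} (hx : x ∈ Ioo 0 π) (hy : y ∈ Ioo 0 π) (h : cot x = cot y) : x = y := by
  rcases lt_trichotomy x y with h' | h' | h'
  · exact absurd h (cot_lt_cot hx.1 h' hy.2).ne'
  · exact h'
  · exact absurd h (cot_lt_cot hy.1 h' hx.2).ne

lemma arccot_mem_Ioo (x : ℝ) : arccot x ∈ Ioo 0 π := by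
  have h1 := arctan_lt_pi_div_two x
  have h2 := neg_pi_div_two_lt_arctan x
  rw [arccot]
  exact ⟨by linarith, by linarith⟩

lemma cot_arccot (x : ℝ) : cot (arccot x) = x := by
  rw [arccot, cot_eq_cos_div_sin, cos_pi_div_two_sub, sin_pi_div_two_sub, ← tan_eq_sin_div_cos,
    tan_arctan]

lemma arccot_cot {x : ℝ} (hx : x ∈ Ioo 0 π) : arccot (cot x) = x :=
  cot_inj (arccot_mem_Ioo _) hx (cot_arccot _)

lemma arccot_neg (x : ℝ) : arccot (-x) = π - arccot x := by
  rw [arccot, arccot, arctan_neg]; ring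

lemma cot_pi_div_two : cot (π / 2) = 0 := by
  rw [cot_eq_cos_div_sin, cos_pi_div_two, zero_div]

lemma pi_div_two_mem : π / 2 ∈ Ioo 0 π := ⟨by linarith [pi_pos], by linarith [pi_pos]⟩

lemma tendsto_cot_zero : Tendsto cot (𝓝[>] 0) atTop := by
  have h : (cot : ℝ → ℝ) = fun x => cos x * (sin x)⁻¹ := by
    funext x; rw [cot_eq_cos_div_sin, div_eq_mul_inv]
  rw [h]
  have h1 : Tendsto cos (𝓝[>] 0) (𝓝 1) := by
    have := (continuous_cos.tendsto 0).mono_left (nhdsWithin_le_nhds (s := Ioi 0))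
    rwa [cos_zero] at this
  have h2 : Tendsto sin (𝓝[>] 0) (𝓝[>] 0) := by
    refine tendsto_nhdsWithin_iff.2 ⟨?_, ?_⟩
    · have := (continuous_sin.tendsto 0).mono_left (nhdsWithin_le_nhds (s := Ioi 0))
      rwa [sin_zero] at this
    · filter_upwards [Ioo_mem_nhdsGT pi_pos] with x hx
      exact sin_pos_of_pos_of_lt_pi hx.1 hx.2
  exact h1.pos_mul_atTop one_pos (tendsto_inv_nhdsGT_zero.comp h2)

lemma tendsto_cot_pi : Tendsto cot (𝓝[<] π) atBot := by
  have h : (cot : ℝ → ℝ) = fun x => -cot (π - x) := by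
    funext x
    rw [cot_eq_cos_div_sin, cot_eq_cos_div_sin, cos_pi_sub, sin_pi_sub]
    ring
  rw [h]
  refine tendsto_neg_atTop_atBot.comp (tendsto_cot_zero.comp ?_)
  refine tendsto_nhdsWithin_iff.2 ⟨?_, ?_⟩
  · have := ((continuous_const.sub continuous_id).tendsto π).mono_left
      (nhdsWithin_le_nhds (s := Iio π)) (f := fun x : ℝ => π - x)
    simpa using this
  · filter_upwards [self_mem_nhdsWithin] with x hx
    exact sub_pos.2 (show x < π from hx)

end Cotangent

/-! ### Explicit integration under `u = m`. -/

section SaturatedArc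

variable {m : ℝ}

lemma sqrt_four_mul_sq_sub_one_pos (hm : 1 / 2 < m) : 0 < √(4 * m ^ 2 - 1) :=
  sqrt_pos.2 (by nlinarith)

lemma sq_sqrt_four_mul_sq_sub_one (hm : 1 / 2 < m) : √(4 * m ^ 2 - 1) ^ 2 = 4 * m ^ 2 - 1 :=
  sq_sqrt (by nlinarith)

/-- A primitive of the rate of change of the logarithmic radius under `u = m`. -/
noncomputable def saturatedPrimitive (m x : ℝ) : ℝ :=
  -(log (2 * m - sin (2 * x)) / 2) -
    arccot ((2 * m * cot x - 1) / √(4 * m ^ 2 - 1)) / √(4 * m ^ 2 - 1)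

lemma two_mul_sub_sin_pos (hm : 1 / 2 < m) (x : ℝ) : 0 < 2 * m - sin (2 * x) := by
  linarith [sin_le_one (2 * x)]

/-- In the variable `cot x` the integral is that of a rational function; partial fractions give the
logarithm, and completing the square in `m * cot x ^ 2 - cot x + m` gives the inverse cotangent. -/
lemma hasDerivAt_saturatedPrimitive (hm : 1 / 2 < m) {x : ℝ} (hx : sin x ≠ 0) :
    HasDerivAt (saturatedPrimitive m) (-(sin x ^ 2 / (m - sin x * cos x))) x := by
  have hq := sqrt_four_mul_sq_sub_one_pos hm
  have hq2 := sq_sqrt_four_mul_sq_sub_one hm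
  have hD := saturated_speed_pos hm x
  have hD2 := two_mul_sub_sin_pos hm x
  set q := √(4 * m ^ 2 - 1) with hqdef
  have h1 : HasDerivAt (fun x => 2 * m - sin (2 * x)) (-(cos (2 * x) * 2)) x := by
    have := (((hasDerivAt_id x).const_mul 2).sin).const_sub (2 * m)
    simpa using this
  have h2 : HasDerivAt (fun x => (2 * m * cot x - 1) / q) (2 * m * (-(1 / sin x ^ 2)) / q) x :=
    (((hasDerivAt_cot hx).const_mul (2 * m)).sub_const 1).div_const q
  have h3 := ((h1.log hD2.ne').div_const 2).neg.sub (((h2.arctan).const_sub (π / 2)).div_const q)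
  have h4 : (1 : ℝ) + ((2 * m * cot x - 1) / q) ^ 2 =
      4 * m * (m - sin x * cos x) / (q ^ 2 * sin x ^ 2) := by
    rw [cot_eq_cos_div_sin]
    field_simp
    rw [hq2]
    linear_combination (4 * m ^ 2) * sin_sq_add_cos_sq x
  have hm0 : m ≠ 0 := by linarith
  have e : 2 * m - 2 * sin x * cos x = 2 * (m - sin x * cos x) := by ring
  have e' : -(sin x ^ 2 / (m - sin x * cos x)) =
      -(-(cos (2 * x) * 2) / (2 * m - sin (2 * x)) / 2) -
      -(1 / (1 + ((2 * m * cot x - 1) / q) ^ 2) * (2 * m * -(1 / sin x ^ 2) / q)) / q := by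
    rw [h4, cos_two_mul', sin_two_mul, e]
    generalize m - sin x * cos x = D at *
    field_simp
    linear_combination (-4 : ℝ) * sin_sq_add_cos_sq x
  rw [e']
  exact h3

lemma integral_saturated (hm : 1 / 2 < m) {α β : ℝ} (hα : 0 < α) (hαβ : α ≤ β) (hβ : β < π) :
    exp (-∫ x in α..β, sin x ^ 2 / (m - sin x * cos x)) = saturatedRatio m α β := by
  have hsin : ∀ x ∈ uIcc α β, sin x ≠ 0 := by
    intro x hx
    rw [uIcc_of_le hαβ] at hx
    exact (sin_pos_of_pos_of_lt_pi (hα.trans_le hx.1) (hx.2.trans_lt hβ)).ne'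
  have hA := two_mul_sub_sin_pos hm α
  have hB := two_mul_sub_sin_pos hm β
  rw [← intervalIntegral.integral_neg, intervalIntegral.integral_eq_sub_of_hasDerivAt
    (fun x hx => hasDerivAt_saturatedPrimitive hm (hsin x hx))
    ((continuous_saturatedDecay_integrand hm).neg.intervalIntegrable _ _), saturatedRatio,
    ← exp_log (div_pos hA hB), ← exp_half, ← exp_add, log_div hA.ne' hB.ne', saturatedPrimitive,
    saturatedPrimitive]
  congr 1
  ring

/-- At the poles `cot` takes the default value `0` while diverging nearby, so the primitive enters
through its one-sided limits. -/
lemma tendsto_saturatedPrimitive_zero (hm : 1 / 2 < m) :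
    Tendsto (saturatedPrimitive m) (𝓝[>] 0) (𝓝 (-(log (2 * m) / 2))) := by
  have hq := sqrt_four_mul_sq_sub_one_pos hm
  have h1 : Tendsto (fun x => -(log (2 * m - sin (2 * x)) / 2)) (𝓝[>] 0)
      (𝓝 (-(log (2 * m) / 2))) := by
    have hc : ContinuousAt (fun x => 2 * m - sin (2 * x)) 0 := by fun_prop
    have h := ((hc.log (two_mul_sub_sin_pos hm 0).ne').div_const 2).tendsto.mono_left
      (nhdsWithin_le_nhds (s := Ioi 0))
    have h' : Tendsto (fun x => log (2 * m - sin (2 * x)) / 2) (𝓝[>] 0) (𝓝 (log (2 * m) / 2)) := by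
      simpa using h
    exact h'.neg
  have h2 : Tendsto (fun x => (2 * m * cot x - 1) / √(4 * m ^ 2 - 1)) (𝓝[>] 0) atTop :=
    (tendsto_atTop_add_const_right _ (-1)
      (tendsto_cot_zero.const_mul_atTop (by linarith : 0 < 2 * m))).atTop_div_const hq
  have h3 : Tendsto (fun x => arccot ((2 * m * cot x - 1) / √(4 * m ^ 2 - 1))) (𝓝[>] 0) (𝓝 0) := by
    have := ((tendsto_arctan_atTop.mono_right nhdsWithin_le_nhds).comp h2).const_sub (π / 2)
    simpa [arccot, Function.comp_def] using this
  have := h1.sub (h3.div_const √(4 * m ^ 2 - 1))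
  rw [zero_div, sub_zero] at this
  exact this

lemma tendsto_saturatedPrimitive_pi (hm : 1 / 2 < m) :
    Tendsto (saturatedPrimitive m) (𝓝[<] π)
      (𝓝 (-(log (2 * m) / 2) - π / √(4 * m ^ 2 - 1))) := by
  have hq := sqrt_four_mul_sq_sub_one_pos hm
  have h1 : Tendsto (fun x => -(log (2 * m - sin (2 * x)) / 2)) (𝓝[<] π)
      (𝓝 (-(log (2 * m) / 2))) := by
    have hc : ContinuousAt (fun x => 2 * m - sin (2 * x)) π := by fun_prop
    have h := ((hc.log (two_mul_sub_sin_pos hm π).ne').div_const 2).tendsto.mono_left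
      (nhdsWithin_le_nhds (s := Iio π))
    have h' : Tendsto (fun x => log (2 * m - sin (2 * x)) / 2) (𝓝[<] π) (𝓝 (log (2 * m) / 2)) := by
      simpa using h
    exact h'.neg
  have h2 : Tendsto (fun x => (2 * m * cot x - 1) / √(4 * m ^ 2 - 1)) (𝓝[<] π) atBot :=
    (tendsto_atBot_add_const_right _ (-1)
      (tendsto_cot_pi.const_mul_atBot (by linarith : 0 < 2 * m))).atBot_div_const hq
  have h3 : Tendsto (fun x => arccot ((2 * m * cot x - 1) / √(4 * m ^ 2 - 1))) (𝓝[<] π) (𝓝 π) := by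
    have := ((tendsto_arctan_atBot.mono_right nhdsWithin_le_nhds).comp h2).const_sub (π / 2)
    simpa [arccot, Function.comp_def] using this
  exact h1.sub (h3.div_const √(4 * m ^ 2 - 1))

lemma exp_neg_saturatedDecay_pi (hm : 1 / 2 < m) : exp (-saturatedDecay m π) = rC1 m := by
  rw [saturatedDecay, ← intervalIntegral.integral_neg,
    intervalIntegral.integral_eq_sub_of_hasDerivAt_of_tendsto pi_pos
    (fun x hx => hasDerivAt_saturatedPrimitive hm (sin_pos_of_pos_of_lt_pi hx.1 hx.2).ne')
    ((continuous_saturatedDecay_integrand hm).neg.intervalIntegrable _ _)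
    (tendsto_saturatedPrimitive_zero hm) (tendsto_saturatedPrimitive_pi hm), rC1]
  congr 1
  ring

lemma exp_neg_saturatedDecay_pi_div_two (hm : 1 / 2 < m) :
    exp (-saturatedDecay m (π / 2)) = rD1 m := by
  have hs : ∀ x ∈ Ioc 0 (π / 2), sin x ≠ 0 := fun x hx =>
    (sin_pos_of_pos_of_lt_pi hx.1 (hx.2.trans_lt pi_div_two_mem.2)).ne'
  rw [saturatedDecay, ← intervalIntegral.integral_neg,
    intervalIntegral.integral_eq_sub_of_hasDerivAt_of_tendsto pi_div_two_pos
    (fun x hx => hasDerivAt_saturatedPrimitive hm (hs x (Ioo_subset_Ioc_self hx)))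
    ((continuous_saturatedDecay_integrand hm).neg.intervalIntegrable _ _)
    (tendsto_saturatedPrimitive_zero hm)
    ((hasDerivAt_saturatedPrimitive hm (hs _ ⟨pi_div_two_pos, le_rfl⟩)).continuousAt.tendsto.mono_left
      nhdsWithin_le_nhds), rD1, saturatedPrimitive, cot_pi_div_two, mul_div_cancel₀ π two_ne_zero,
    sin_pi, mul_zero, zero_sub, neg_div, arccot_neg]
  congr 1
  ring_nf

end SaturatedArc

/-! ### Where the bound is active: the switching angles. -/

section Switching

variable {m κ θ₁ θ₂ θτ : ℝ}

/-- Multiplication by the conjugate removes the root and leaves a quadratic in `cot x`; the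
conjugate factor is positive when `sin x > 0`, so signs can be read off. -/
lemma regularLaw_sub (m κ : ℝ) {x : ℝ} (hx : sin x ≠ 0) :
    (regularLaw κ x - m) * (sin x * √(cos x ^ 2 + κ ^ 2) + (m - sin x * cos x)) =
      sin x ^ 2 * (κ ^ 2 - ((m * cot x - 1) ^ 2 + m ^ 2 - 1)) := by
  have hc : cot x * sin x = cos x := by rw [cot_eq_cos_div_sin]; field_simp
  rw [regularLaw, ← hc]
  have h1 := sq_sqrt_cos κ x
  have h2 := sin_sq_add_cos_sq x
  rw [← hc] at h1 h2
  linear_combination sin x ^ 2 * h1 + m ^ 2 * h2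

lemma lt_regularLaw_iff (hm : 1 / 2 < m) {x : ℝ} (hx : 0 < sin x) :
    m < regularLaw κ x ↔ (m * cot x - 1) ^ 2 + m ^ 2 - 1 < κ ^ 2 := by
  have h := regularLaw_sub m κ hx.ne'
  have h1 : 0 < sin x * √(cos x ^ 2 + κ ^ 2) + (m - sin x * cos x) :=
    add_pos_of_nonneg_of_pos (mul_nonneg hx.le (sqrt_nonneg _)) (saturated_speed_pos hm x)
  have h2 : 0 < sin x ^ 2 := pow_pos hx 2
  constructor
  · intro hlt
    have : 0 < sin x ^ 2 * (κ ^ 2 - ((m * cot x - 1) ^ 2 + m ^ 2 - 1)) := by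
      rw [← h]; exact mul_pos (sub_pos.2 hlt) h1
    linarith [pos_of_mul_pos_right this h2.le]
  · intro hlt
    have : 0 < (regularLaw κ x - m) * (sin x * √(cos x ^ 2 + κ ^ 2) + (m - sin x * cos x)) := by
      rw [h]; exact mul_pos h2 (sub_pos.2 hlt)
    linarith [pos_of_mul_pos_left this h1.le]

lemma regularLaw_le_of_sq_le (hm : 1 / 2 < m) {x : ℝ} (hκ : κ ^ 2 ≤ m ^ 2 - 1) (hx : 0 ≤ sin x) :
    regularLaw κ x ≤ m := by
  rcases hx.eq_or_lt with h | h
  · rw [regularLaw, ← h, zero_mul]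
    linarith
  · by_contra! hlt
    have := (lt_regularLaw_iff hm h).1 hlt
    nlinarith [sq_nonneg (m * cot x - 1)]

lemma decay_of_regularLaw_le (hm : 1 / 2 < m) (hκ : 0 < κ) {x : ℝ} (hx : 0 ≤ sin x)
    (h : regularLaw κ x ≤ m) : decay m κ x = sin x / √(cos x ^ 2 + κ ^ 2) := by
  have h1 := saturated_speed_pos hm x
  have h2 := sqrt_cos_pos hκ x
  rw [regularLaw] at h
  rw [decay, max_eq_left hx, max_eq_right]
  rw [div_le_div_iff₀ h1 h2]
  nlinarith

lemma decay_of_le_regularLaw (hm : 1 / 2 < m) (hκ : 0 < κ) {x : ℝ} (hx : 0 ≤ sin x)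
    (h : m ≤ regularLaw κ x) : decay m κ x = sin x ^ 2 / (m - sin x * cos x) := by
  have h1 := saturated_speed_pos hm x
  have h2 := sqrt_cos_pos hκ x
  rw [regularLaw] at h
  rw [decay, max_eq_left hx, max_eq_left]
  rw [div_le_div_iff₀ h2 h1]
  nlinarith

lemma exp_neg_totalDecay_of_sq_le (hm : 1 / 2 < m) (hκ : 0 < κ) (hκm : κ ^ 2 ≤ m ^ 2 - 1)
    (hτ : θτ = π / 2 ∨ θτ = π) : exp (-totalDecay m κ θτ) = regularRatio κ 0 θτ := by
  rw [← integral_regular hκ, totalDecay]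
  congr 2
  refine intervalIntegral.integral_congr fun x hx => ?_
  rw [uIcc_of_le (target_pos hτ).le] at hx
  have hs := sin_nonneg_of_mem hτ hx
  exact decay_of_regularLaw_le hm hκ hs (regularLaw_le_of_sq_le hm hκm hs)

theorem isMinimumEnergyFeedback_regularLaw (hm : 1 / 2 < m) (hκ : 0 < κ)
    (hκm : κ ^ 2 ≤ m ^ 2 - 1) (hτ : θτ = π / 2 ∨ θτ = π) :
    IsMinimumEnergyFeedback m (regularRatio κ 0 θτ) θτ (regularLaw κ) := by
  rw [← exp_neg_totalDecay_of_sq_le hm hκ hκm hτ]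
  refine (isMinimumEnergyFeedback_min hm hκ hτ).congr fun x hx => ?_
  exact min_eq_right (regularLaw_le_of_sq_le hm hκm (sin_nonneg_of_mem hτ hx))

lemma exists_switchingAngles (hm : 1 / 2 < m) (hκ : 0 < κ) (hκm : m ^ 2 - 1 < κ ^ 2) :
    ∃ θ₁ θ₂, SwitchingAngles m κ θ₁ θ₂ := by
  have hm0 : 0 < m := by linarith
  -- The switching values of `m * cot θ` are the two roots `1 ± D`.
  set D := √(κ ^ 2 - (m ^ 2 - 1)) with hD
  have hD0 : 0 < D := sqrt_pos.2 (by linarith)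
  have hD2 : D ^ 2 = κ ^ 2 - (m ^ 2 - 1) := sq_sqrt (by linarith)
  refine ⟨arccot ((1 + D) / m), arccot ((1 - D) / m), hκ, (arccot_mem_Ioo _).1, ?_,
    (arccot_mem_Ioo _).2, ?_, ?_, ?_⟩
  · rw [← cot_lt_cot_iff (arccot_mem_Ioo _) (arccot_mem_Ioo _), cot_arccot, cot_arccot]
    gcongr
    linarith
  · rw [cot_arccot, mul_div_cancel₀ _ hm0.ne']
    linarith
  · rw [cot_arccot, mul_div_cancel₀ _ hm0.ne']
    linarith
  · rw [cot_arccot, cot_arccot]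
    ring

namespace SwitchingAngles

lemma first_mem (h : SwitchingAngles m κ θ₁ θ₂) : θ₁ ∈ Ioo 0 π :=
  ⟨h.first_pos, h.first_lt_second.trans h.second_lt_pi⟩

lemma second_mem (h : SwitchingAngles m κ θ₁ θ₂) : θ₂ ∈ Ioo 0 π :=
  ⟨h.first_pos.trans h.first_lt_second, h.second_lt_pi⟩

lemma mul_cot_add (hm : 1 / 2 < m) (h : SwitchingAngles m κ θ₁ θ₂) :
    m * cot θ₁ + m * cot θ₂ = 2 := by
  have hm0 : m ≠ 0 := by linarith
  rw [← mul_add, h.cot_add_cot, mul_div_cancel₀ _ hm0]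

lemma one_lt_mul_cot (hm : 1 / 2 < m) (h : SwitchingAngles m κ θ₁ θ₂) : 1 < m * cot θ₁ := by
  have h1 := cot_lt_cot h.first_pos h.first_lt_second h.second_lt_pi
  have h2 := h.mul_cot_add hm
  nlinarith

/-- The parameter fixes `(m * cot θ₁ - 1) ^ 2`, and `1 < m * cot θ₁` selects the root. -/
lemma eq_of_kappa_eq (hm : 1 / 2 < m) {θ₁' θ₂' : ℝ} (h : SwitchingAngles m κ θ₁ θ₂)
    (h' : SwitchingAngles m κ θ₁' θ₂') : θ₁' = θ₁ ∧ θ₂' = θ₂ := by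
  have hm0 : m ≠ 0 := by linarith
  have e1 : m * cot θ₁' = m * cot θ₁ := by
    have h1 := h.one_lt_mul_cot hm
    have h2 := h'.one_lt_mul_cot hm
    have h3 : (m * cot θ₁' - 1) ^ 2 = (m * cot θ₁ - 1) ^ 2 := by
      linarith [h.kappa_first, h'.kappa_first]
    rw [sq_eq_sq₀ (by linarith) (by linarith)] at h3
    linarith
  have e2 : m * cot θ₂' = m * cot θ₂ := by linarith [h.mul_cot_add hm, h'.mul_cot_add hm]
  exact ⟨cot_inj h'.first_mem h.first_mem (mul_left_cancel₀ hm0 e1),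
    cot_inj h'.second_mem h.second_mem (mul_left_cancel₀ hm0 e2)⟩

/-- The values of `m * cot` at the switching angles lie symmetrically about `1`, the vertex of the
quadratic. -/
lemma lt_regularLaw_iff_mem (hm : 1 / 2 < m) (h : SwitchingAngles m κ θ₁ θ₂) {x : ℝ}
    (hx : x ∈ Ioo 0 π) : m < regularLaw κ x ↔ θ₁ < x ∧ x < θ₂ := by
  have hm0 : 0 < m := by linarith
  have h1 := h.one_lt_mul_cot hm
  have h2 := h.mul_cot_add hm
  rw [lt_regularLaw_iff hm (sin_pos_of_pos_of_lt_pi hx.1 hx.2), h.kappa_first,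
    ← cot_lt_cot_iff h.first_mem hx, ← cot_lt_cot_iff hx h.second_mem,
    ← mul_lt_mul_iff_right₀ (b := cot x) hm0, ← mul_lt_mul_iff_right₀ (b := cot θ₂) hm0]
  constructor
  · intro h3
    have h4 := abs_lt_of_sq_lt_sq (by linarith : (m * cot x - 1) ^ 2 < (m * cot θ₁ - 1) ^ 2)
      (by linarith)
    rw [abs_lt] at h4
    exact ⟨by linarith [h4.2], by linarith [h4.1]⟩
  · rintro ⟨h3, h4⟩
    have := sq_lt_sq' (by linarith : -(m * cot θ₁ - 1) < m * cot x - 1) (by linarith)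
    linarith

lemma lt_regularLaw_iff (hm : 1 / 2 < m) (h : SwitchingAngles m κ θ₁ θ₂) {x : ℝ}
    (hx : x ∈ Icc 0 π) : m < regularLaw κ x ↔ θ₁ < x ∧ x < θ₂ := by
  rcases hx.1.eq_or_lt with h0 | h0
  · have : regularLaw κ x = 0 := by rw [regularLaw, ← h0, sin_zero, zero_mul]
    rw [this]
    constructor <;> intro h' <;> linarith [h.first_pos]
  rcases hx.2.eq_or_lt with h0' | h0'
  · have : regularLaw κ x = 0 := by rw [regularLaw, h0', sin_pi, zero_mul]
    rw [this]
    constructor <;> intro h' <;> linarith [h.second_lt_pi]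
  exact h.lt_regularLaw_iff_mem hm ⟨h0, h0'⟩

lemma switchedLaw_eq (hm : 1 / 2 < m) (h : SwitchingAngles m κ θ₁ θ₂) {x : ℝ}
    (hx : x ∈ Icc 0 π) : switchedLaw m κ θ₁ θ₂ x = min m (regularLaw κ x) := by
  rw [switchedLaw]
  split_ifs with hc
  · exact (min_eq_left ((h.lt_regularLaw_iff hm hx).2 hc).le).symm
  · exact (min_eq_right (not_lt.1 (mt (h.lt_regularLaw_iff hm hx).1 hc))).symm

lemma isMinimumEnergyFeedback (hm : 1 / 2 < m) (h : SwitchingAngles m κ θ₁ θ₂)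
    (hτ : θτ = π / 2 ∨ θτ = π) :
    IsMinimumEnergyFeedback m (exp (-totalDecay m κ θτ)) θτ (switchedLaw m κ θ₁ θ₂) :=
  (isMinimumEnergyFeedback_min hm h.kappa_pos hτ).congr fun _ hx =>
    (h.switchedLaw_eq hm ⟨hx.1, hx.2.trans (target_le_pi hτ)⟩).symm

lemma le_regularLaw (hm : 1 / 2 < m) (h : SwitchingAngles m κ θ₁ θ₂) {x : ℝ}
    (hx : x ∈ Icc θ₁ θ₂) : m ≤ regularLaw κ x := by
  have hc : Continuous (regularLaw κ) := by unfold regularLaw; fun_prop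
  have hx' : x ∈ closure (Ioo θ₁ θ₂) := by rwa [closure_Ioo h.first_lt_second.ne]
  refine closure_minimal (fun y hy => ?_) (isClosed_le continuous_const hc) hx'
  exact ((h.lt_regularLaw_iff hm ⟨(h.first_pos.trans hy.1).le, (hy.2.trans h.second_lt_pi).le⟩).2
    hy).le

lemma integral_decay_first (hm : 1 / 2 < m) (h : SwitchingAngles m κ θ₁ θ₂) :
    exp (-∫ x in 0..θ₁, decay m κ x) = regularRatio κ 0 θ₁ := by
  rw [← integral_regular h.kappa_pos]
  congr 2
  refine intervalIntegral.integral_congr fun x hx => ?_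
  rw [uIcc_of_le h.first_pos.le] at hx
  have hxπ : x ∈ Icc 0 π := ⟨hx.1, hx.2.trans h.first_mem.2.le⟩
  exact decay_of_regularLaw_le hm h.kappa_pos (sin_nonneg_of_nonneg_of_le_pi hxπ.1 hxπ.2)
    (not_lt.1 fun hlt => ((h.lt_regularLaw_iff hm hxπ).1 hlt).1.not_ge hx.2)

lemma integral_decay_middle (hm : 1 / 2 < m) (h : SwitchingAngles m κ θ₁ θ₂) {β : ℝ}
    (h1 : θ₁ ≤ β) (h2 : β ≤ θ₂) :
    exp (-∫ x in θ₁..β, decay m κ x) = saturatedRatio m θ₁ β := by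
  rw [← integral_saturated hm h.first_pos h1 (h2.trans_lt h.second_lt_pi)]
  congr 2
  refine intervalIntegral.integral_congr fun x hx => ?_
  rw [uIcc_of_le h1] at hx
  exact decay_of_le_regularLaw hm h.kappa_pos (sin_nonneg_of_nonneg_of_le_pi
    (h.first_pos.le.trans hx.1) ((hx.2.trans h2).trans h.second_lt_pi.le))
    (h.le_regularLaw hm ⟨hx.1, hx.2.trans h2⟩)

lemma integral_decay_last (hm : 1 / 2 < m) (h : SwitchingAngles m κ θ₁ θ₂) {β : ℝ}
    (h1 : θ₂ ≤ β) (h2 : β ≤ π) :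
    exp (-∫ x in θ₂..β, decay m κ x) = regularRatio κ θ₂ β := by
  rw [← integral_regular h.kappa_pos]
  congr 2
  refine intervalIntegral.integral_congr fun x hx => ?_
  rw [uIcc_of_le h1] at hx
  have hxπ : x ∈ Icc 0 π := ⟨h.second_mem.1.le.trans hx.1, hx.2.trans h2⟩
  exact decay_of_regularLaw_le hm h.kappa_pos (sin_nonneg_of_nonneg_of_le_pi hxπ.1 hxπ.2)
    (not_lt.1 fun hlt => ((h.lt_regularLaw_iff hm hxπ).1 hlt).2.not_ge hx.1)

lemma exp_neg_totalDecay_two (hm : 1 / 2 < m) (h : SwitchingAngles m κ θ₁ θ₂) (h1 : θ₂ ≤ θτ)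
    (h2 : θτ ≤ π) : exp (-totalDecay m κ θτ) =
      regularRatio κ 0 θ₁ * saturatedRatio m θ₁ θ₂ * regularRatio κ θ₂ θτ := by
  have hi : ∀ a b, IntervalIntegrable (decay m κ) volume a b := fun a b =>
    (continuous_decay hm h.kappa_pos).intervalIntegrable a b
  rw [← h.integral_decay_first hm, ← h.integral_decay_middle hm h.first_lt_second.le le_rfl,
    ← h.integral_decay_last hm h1 h2, ← exp_add, ← exp_add, totalDecay,
    ← intervalIntegral.integral_add_adjacent_intervals (hi 0 θ₂) (hi θ₂ θτ),
    ← intervalIntegral.integral_add_adjacent_intervals (hi 0 θ₁) (hi θ₁ θ₂)]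
  congr 1
  ring

lemma exp_neg_totalDecay_one (hm : 1 / 2 < m) (h : SwitchingAngles m κ θ₁ θ₂) (h1 : θ₁ ≤ θτ)
    (h2 : θτ ≤ θ₂) : exp (-totalDecay m κ θτ) =
      regularRatio κ 0 θ₁ * saturatedRatio m θ₁ θτ := by
  have hi : ∀ a b, IntervalIntegrable (decay m κ) volume a b := fun a b =>
    (continuous_decay hm h.kappa_pos).intervalIntegrable a b
  rw [← h.integral_decay_first hm, ← h.integral_decay_middle hm h1 h2, ← exp_add, totalDecay,
    ← intervalIntegral.integral_add_adjacent_intervals (hi 0 θ₁) (hi θ₁ θτ)]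
  congr 1
  ring

/-- Any solution of the equations yields the same total decay, which determines `κ` and then the
angles. -/
lemma optimalTwoSwitchings (hm : 1 / 2 < m) (h : SwitchingAngles m κ θ₁ θ₂)
    (hτ : θτ = π / 2 ∨ θτ = π) (h1 : θ₂ ≤ θτ) :
    OptimalTwoSwitchings m (exp (-totalDecay m κ θτ)) θτ κ θ₁ θ₂ := by
  refine ⟨⟨h, h1, h.exp_neg_totalDecay_two hm h1 (target_le_pi hτ)⟩, fun κ' θ₁' θ₂' h' => ?_,
    h.isMinimumEnergyFeedback hm hτ⟩
  have h2 := h'.radius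
  rw [← h'.angles.exp_neg_totalDecay_two hm h'.second_le (target_le_pi hτ), exp_eq_exp,
    neg_inj] at h2
  obtain rfl := totalDecay_inj hm h.kappa_pos h'.angles.kappa_pos hτ h2
  exact ⟨rfl, h.eq_of_kappa_eq hm h'.angles⟩

lemma optimalOneSwitching (hm : 1 / 2 < m) (h : SwitchingAngles m κ θ₁ θ₂)
    (hτ : θτ = π / 2 ∨ θτ = π) (h1 : θ₁ < θτ) (h2 : θτ < θ₂) :
    OptimalOneSwitching m (exp (-totalDecay m κ θτ)) θτ κ θ₁ θ₂ := by
  refine ⟨⟨h, h1, h2, h.exp_neg_totalDecay_one hm h1.le h2.le⟩, fun κ' θ₁' θ₂' h' => ?_,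
    h.isMinimumEnergyFeedback hm hτ⟩
  have h3 := h'.radius
  rw [← h'.angles.exp_neg_totalDecay_one hm h'.first_lt.le h'.lt_second.le, exp_eq_exp,
    neg_inj] at h3
  obtain rfl := totalDecay_inj hm h.kappa_pos h'.angles.kappa_pos hτ h3
  exact ⟨rfl, h.eq_of_kappa_eq hm h'.angles⟩

lemma first_lt_pi_div_two (hm : 1 / 2 < m) (h : SwitchingAngles m κ θ₁ θ₂) : θ₁ < π / 2 := by
  rw [← cot_lt_cot_iff h.first_mem pi_div_two_mem, cot_pi_div_two]
  have := h.one_lt_mul_cot hm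
  by_contra! hneg
  nlinarith

/-- From `κ ^ 2 - m ^ 2 = (1 - m * cot θ₂) ^ 2 - 1` and `m * cot θ₂ < 1`, the sign is opposite to
that of `cot θ₂`. -/
lemma pi_div_two_lt_iff (hm : 1 / 2 < m) (h : SwitchingAngles m κ θ₁ θ₂) :
    π / 2 < θ₂ ↔ m < κ := by
  have hκ := h.kappa_pos
  have h1 := h.one_lt_mul_cot hm
  have h2 := h.mul_cot_add hm
  have h3 := h.kappa_second
  rw [← cot_lt_cot_iff pi_div_two_mem h.second_mem, cot_pi_div_two]
  have hm0 : 0 < m := by linarith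
  constructor
  · intro h4
    have h5 : m * cot θ₂ < 0 := mul_neg_of_pos_of_neg hm0 h4
    exact lt_of_pow_lt_pow_left₀ 2 hκ.le (by nlinarith)
  · intro h4
    by_contra! h5
    have h6 : 0 ≤ m * cot θ₂ := mul_nonneg hm0.le h5
    nlinarith

lemma second_eq_pi_div_two_iff (hm : 1 / 2 < m) (h : SwitchingAngles m κ θ₁ θ₂) :
    θ₂ = π / 2 ↔ κ = m := by
  have hκ := h.kappa_pos
  have h1 := h.one_lt_mul_cot hm
  have h2 := h.mul_cot_add hm
  have h3 := h.kappa_second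
  have hm0 : 0 < m := by linarith
  constructor
  · intro h4
    rw [h4, cot_pi_div_two] at h3
    have : κ ^ 2 = m ^ 2 := by linarith
    exact (sq_eq_sq₀ hκ.le hm0.le).1 this
  · rintro rfl
    refine cot_inj h.second_mem pi_div_two_mem ?_
    rw [cot_pi_div_two]
    have h4 : (1 - κ * cot θ₂) ^ 2 = 1 ^ 2 := by linarith
    rw [sq_eq_sq₀ (by linarith) zero_le_one] at h4
    have h5 : κ * cot θ₂ = 0 := by linarith
    exact (mul_eq_zero.1 h5).resolve_left hm0.ne'

end SwitchingAngles

end Switching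


/-! ### Evaluation of the threshold radii. -/

section Thresholds

variable {m κ : ℝ}

lemma regularRatio_pi (κ : ℝ) :
    regularRatio κ 0 π = (√(1 + κ ^ 2) - 1) / (√(1 + κ ^ 2) + 1) := by
  simp only [regularRatio, cos_pi, cos_zero, neg_one_sq, one_pow]
  ring

lemma regularRatio_pi_div_two (hκ : 0 < κ) :
    regularRatio κ 0 (π / 2) = κ / (1 + √(1 + κ ^ 2)) := by
  simp [regularRatio, sqrt_sq hκ.le]

lemma regularRatio_pi_le (hm : 1 / 2 < m) (hκm : κ ^ 2 ≤ m ^ 2 - 1) :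
    regularRatio κ 0 π ≤ rC2 m := by
  have h1 : √(1 + κ ^ 2) ≤ m := sqrt_le_iff.2 ⟨by linarith, by linarith⟩
  have h2 := sqrt_nonneg (1 + κ ^ 2)
  rw [regularRatio_pi, rC2, div_le_div_iff₀ (by linarith) (by linarith)]
  nlinarith

lemma regularRatio_pi_self {r : ℝ} (h0 : 0 < r) (h1 : r < 1) :
    regularRatio (2 * √r / (1 - r)) 0 π = r := by
  have h2 : 0 < 1 - r := by linarith
  -- The value of `κ` comes from solving `(Q - 1) / (Q + 1) = r` for `Q = √(1 + κ ^ 2)`.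
  have h3 : 1 + (2 * √r / (1 - r)) ^ 2 = ((1 + r) / (1 - r)) ^ 2 := by
    rw [div_pow, mul_pow, sq_sqrt h0.le]
    field_simp
    ring
  rw [regularRatio_pi, h3, sqrt_sq (by positivity)]
  field_simp
  ring

lemma regularRatio_pi_div_two_self {r : ℝ} (h0 : 0 < r) (h1 : r < 1) :
    regularRatio (2 * r / (1 - r ^ 2)) 0 (π / 2) = r := by
  have h2 : 0 < 1 - r ^ 2 := by nlinarith
  have h3 : 1 + (2 * r / (1 - r ^ 2)) ^ 2 = ((1 + r ^ 2) / (1 - r ^ 2)) ^ 2 := by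
    field_simp
    ring
  rw [regularRatio_pi_div_two (by positivity), h3, sqrt_sq (by positivity)]
  field_simp
  ring

lemma rC2_lt_one (hm : 1 / 2 < m) : rC2 m < 1 := by
  rw [rC2, div_lt_one (by linarith)]
  linarith

lemma sq_le_of_le_rC2 (hm : 1 / 2 < m) {r : ℝ} (h0 : 0 < r) (hr : r ≤ rC2 m) :
    (2 * √r / (1 - r)) ^ 2 ≤ m ^ 2 - 1 := by
  have h1 := hr.trans_lt (rC2_lt_one hm)
  rw [rC2, le_div_iff₀ (by linarith)] at hr
  rw [div_pow, mul_pow, sq_sqrt h0.le, div_le_iff₀ (by nlinarith)]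
  have h2 : 1 + r ≤ m * (1 - r) := by linarith
  nlinarith [mul_self_le_mul_self (by linarith) h2]

lemma sq_rD3_le (hm : 1 ≤ m) : rD3 m ^ 2 = rC2 m := by
  rw [rD3, rC2, div_pow, sq_sqrt (by nlinarith), div_eq_div_iff (by positivity) (by positivity)]
  ring

lemma rD3_nonneg (hm : 1 / 2 < m) : 0 ≤ rD3 m := div_nonneg (sqrt_nonneg _) (by linarith)

lemma lt_one_of_le_rD3 (hm : 1 ≤ m) {r : ℝ} (h0 : 0 < r) (hr : r ≤ rD3 m) : r < 1 := by
  have h1 := rC2_lt_one (m := m) (by linarith)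
  have h2 := sq_rD3_le hm
  nlinarith

lemma sq_le_of_le_rD3 (hm : 1 ≤ m) {r : ℝ} (h0 : 0 < r) (hr : r ≤ rD3 m) :
    (2 * r / (1 - r ^ 2)) ^ 2 ≤ m ^ 2 - 1 := by
  have h1 : r ^ 2 ≤ rC2 m := by rw [← sq_rD3_le hm]; gcongr
  have h2 := sq_le_of_le_rC2 (by linarith) (pow_pos h0 2) h1
  rwa [sqrt_sq h0.le] at h2

lemma regularRatio_pi_div_two_le (hm : 1 ≤ m) (hκ : 0 < κ) (hκm : κ ^ 2 ≤ m ^ 2 - 1) :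
    regularRatio κ 0 (π / 2) ≤ rD3 m := by
  have h1 := regularRatio_pi_le (by linarith) hκm
  rw [← sq_rD3_le hm] at h1
  -- The second quarter turn repeats the factor of the first, which transfers the bound from `θ =
  -- π`.
  have h2 : regularRatio κ 0 (π / 2) ^ 2 = regularRatio κ 0 π := by
    have h3 : √(1 + κ ^ 2) ^ 2 = 1 + κ ^ 2 := sq_sqrt (by positivity)
    have h4 := sqrt_nonneg (1 + κ ^ 2)
    rw [regularRatio_pi, regularRatio_pi_div_two hκ, div_pow, div_eq_div_iff (by positivity)
      (by positivity)]
    generalize √(1 + κ ^ 2) = Q at *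
    have : κ ^ 2 = Q ^ 2 - 1 := by linarith
    rw [this]
    ring
  rw [← h2] at h1
  exact le_of_sq_le_sq h1 (rD3_nonneg (by linarith))

/-- Stated with the inverse cotangent, the addition formula needs no restriction on `x * y`: both
sides lie in `(0, π)`. -/
lemma arctan_add_arctan_eq {x y : ℝ} (hx : 0 < x) (hy : 0 < y) :
    arctan x + arctan y = arccot ((1 - x * y) / (x + y)) := by
  have hx1 := cos_arctan_pos x
  have hy1 := cos_arctan_pos y
  have hx2 : sin (arctan x) = x * cos (arctan x) := by
    rw [← tan_mul_cos hx1.ne', tan_arctan]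
  have hy2 : sin (arctan y) = y * cos (arctan y) := by
    rw [← tan_mul_cos hy1.ne', tan_arctan]
  have hmem : arctan x + arctan y ∈ Ioo 0 π :=
    ⟨add_pos (arctan_pos.2 hx) (arctan_pos.2 hy), by
      linarith [arctan_lt_pi_div_two x, arctan_lt_pi_div_two y]⟩
  rw [← arccot_cot hmem, cot_eq_cos_div_sin, cos_add, sin_add, hx2, hy2]
  congr 1
  field_simp

/-- For `κ = m` the second switching is exactly at `π / 2` and `cot θ₁ = 2 / m`, so `θ₁` is an angle
of the right triangle with legs `m`, `2` and hypotenuse `Z`. -/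
lemma exp_neg_totalDecay_self (hm : 1 / 2 < m) : exp (-totalDecay m m (π / 2)) = rD2 m := by
  have hm0 : 0 < m := by linarith
  obtain ⟨θ₁, θ₂, h⟩ := exists_switchingAngles (m := m) (κ := m) hm hm0 (by linarith)
  have hθ₂ : θ₂ = π / 2 := (h.second_eq_pi_div_two_iff hm).2 rfl
  subst hθ₂
  have hq := sqrt_four_mul_sq_sub_one_pos hm
  have hq2 := sq_sqrt_four_mul_sq_sub_one hm
  have hs := sin_pos_of_pos_of_lt_pi h.first_mem.1 h.first_mem.2
  have hcot : cot θ₁ = 2 / m := by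
    have := h.cot_add_cot
    rwa [cot_pi_div_two, add_zero] at this
  have hcos : cos θ₁ = 2 / m * sin θ₁ := by
    rw [← hcot, cot_eq_cos_div_sin]; field_simp
  set Z := √(m ^ 2 + 4) with hZ
  have hZ0 : 0 < Z := sqrt_pos.2 (by positivity)
  have hZ2 : Z ^ 2 = m ^ 2 + 4 := sq_sqrt (by positivity)
  have hsin : sin θ₁ = m / Z := by
    have h1 := sin_sq_add_cos_sq θ₁
    rw [hcos] at h1
    have h2 : (sin θ₁ * Z) ^ 2 = m ^ 2 := by
      rw [mul_pow, hZ2]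
      field_simp at h1
      linarith
    rw [sq_eq_sq₀ (by positivity) hm0.le] at h2
    rw [← h2]
    field_simp
  have hcos' : cos θ₁ = 2 / Z := by rw [hcos, hsin]; field_simp
  have hroot : √(cos θ₁ ^ 2 + m ^ 2) = (m ^ 2 + 2) / Z := by
    rw [hcos', show (2 / Z) ^ 2 + m ^ 2 = ((m ^ 2 + 2) / Z) ^ 2 by
      field_simp; rw [hZ2]; ring, sqrt_sq (by positivity)]
  have hR : regularRatio m 0 θ₁ = Z / (1 + √(m ^ 2 + 1)) := by
    rw [regularRatio, hroot, hcos', cos_zero, one_pow, add_comm 1 (m ^ 2), ← add_div,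
      show 2 + (m ^ 2 + 2) = Z * Z by nlinarith, mul_div_assoc, div_self hZ0.ne', mul_one]
  have hratio : √((2 * m - sin (2 * θ₁)) / (2 * m - sin (2 * (π / 2)))) = √(m ^ 2 + 2) / Z := by
    rw [mul_div_cancel₀ π two_ne_zero, sin_pi, sin_two_mul, hsin, hcos', sub_zero,
      show (2 * m - 2 * (m / Z) * (2 / Z)) / (2 * m) = (m ^ 2 + 2) / Z ^ 2 by
        field_simp; rw [hZ2]; ring, sqrt_div (by positivity), sqrt_sq hZ0.le]
  have hang : arccot ((2 * m * cot (π / 2) - 1) / √(4 * m ^ 2 - 1)) -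
      arccot ((2 * m * cot θ₁ - 1) / √(4 * m ^ 2 - 1)) =
      arccot ((m ^ 2 - 1) / √(4 * m ^ 2 - 1)) := by
    -- The numerators `1` and `3` come from `2 * m * cot - 1`, equal to `-1` at `π / 2` and to `3`
    -- at `θ₁`.
    have h1 := arctan_add_arctan_eq (x := 1 / √(4 * m ^ 2 - 1)) (y := 3 / √(4 * m ^ 2 - 1))
      (by positivity) (by positivity)
    have h2 : (1 - 1 / √(4 * m ^ 2 - 1) * (3 / √(4 * m ^ 2 - 1))) /
        (1 / √(4 * m ^ 2 - 1) + 3 / √(4 * m ^ 2 - 1)) = (m ^ 2 - 1) / √(4 * m ^ 2 - 1) := by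
      field_simp
      rw [hq2]
      ring
    have h3 : 2 * m * (2 / m) - 1 = 3 := by field_simp; norm_num
    rw [h2] at h1
    rw [cot_pi_div_two, hcot, h3, mul_zero, zero_sub, neg_div, ← h1, arccot, arccot, arctan_neg]
    ring
  rw [h.exp_neg_totalDecay_two hm le_rfl pi_div_two_mem.2.le, hR, saturatedRatio, hratio, hang, rD2]
  have hlast : regularRatio m (π / 2) (π / 2) = 1 := by
    rw [regularRatio]
    exact div_self (cos_add_sqrt_pos hm0 _).ne'
  rw [hlast, mul_one, ← mul_assoc]
  congr 1
  · field_simp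
  · congr 1
    ring

lemma exp_neg_totalDecay_lt_rD2_iff (hm : 1 / 2 < m) (hκ : 0 < κ) :
    rD2 m < exp (-totalDecay m κ (π / 2)) ↔ m < κ := by
  rw [← exp_neg_totalDecay_self hm, exp_lt_exp, neg_lt_neg_iff,
    totalDecay_lt_iff hm (by linarith) hκ (Or.inl rfl)]

lemma exp_neg_totalDecay_eq_rD2_iff (hm : 1 / 2 < m) (hκ : 0 < κ) :
    exp (-totalDecay m κ (π / 2)) = rD2 m ↔ κ = m := by
  rw [← exp_neg_totalDecay_self hm, exp_eq_exp, neg_inj]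
  exact ⟨totalDecay_inj hm hκ (by linarith) (Or.inl rfl), fun h => by rw [h]⟩

lemma rD2_lt_rD1 (hm : 1 / 2 < m) : rD2 m < rD1 m := by
  rw [← exp_neg_totalDecay_self hm, ← exp_neg_saturatedDecay_pi_div_two hm, exp_lt_exp,
    neg_lt_neg_iff]
  exact saturatedDecay_lt_totalDecay hm (by linarith) (Or.inl rfl)

end Thresholds

/-! ### The cases of the theorem. -/

section Conclusions

variable {m rτ : ℝ}

/-- The hypothesis `hreg` rules out parameters for which the bound is never active; it covers `m ≥
1` above the threshold and `m < 1` at once. -/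
lemma optimalTwoSwitchings_pi (hm : 1 / 2 < m) (hr : 0 < rτ) (hr1 : rτ < rC1 m)
    (hreg : ∀ κ, 0 < κ → κ ^ 2 ≤ m ^ 2 - 1 → rτ ≠ regularRatio κ 0 π) :
    ∃ κ θ₁ θ₂ : ℝ, OptimalTwoSwitchings m rτ π κ θ₁ θ₂ := by
  rw [← exp_neg_saturatedDecay_pi hm] at hr1
  obtain ⟨κ, hκ, rfl⟩ := exists_totalDecay_eq hm (Or.inr rfl) hr hr1
  have hκm : m ^ 2 - 1 < κ ^ 2 := by
    by_contra! hle
    exact hreg κ hκ hle (exp_neg_totalDecay_of_sq_le hm hκ hle (Or.inr rfl))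
  obtain ⟨θ₁, θ₂, h⟩ := exists_switchingAngles hm hκ hκm
  exact ⟨κ, θ₁, θ₂, h.optimalTwoSwitchings hm (Or.inr rfl) h.second_lt_pi.le⟩

lemma optimalOneSwitching_pi_div_two (hm : 1 / 2 < m) (hr : 0 < rτ) (hr2 : rD2 m < rτ)
    (hr1 : rτ < rD1 m) : ∃ κ θ₁ θ₂ : ℝ, OptimalOneSwitching m rτ (π / 2) κ θ₁ θ₂ := by
  rw [← exp_neg_saturatedDecay_pi_div_two hm] at hr1
  obtain ⟨κ, hκ, rfl⟩ := exists_totalDecay_eq hm (Or.inl rfl) hr hr1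
  have hκm := (exp_neg_totalDecay_lt_rD2_iff hm hκ).1 hr2
  obtain ⟨θ₁, θ₂, h⟩ := exists_switchingAngles hm hκ (by nlinarith)
  exact ⟨κ, θ₁, θ₂, h.optimalOneSwitching hm (Or.inl rfl) (h.first_lt_pi_div_two hm)
    ((h.pi_div_two_lt_iff hm).2 hκm)⟩

lemma optimalTwoSwitchings_pi_div_two (hm : 1 / 2 < m) (hr : 0 < rτ) (hr2 : rτ ≤ rD2 m)
    (hreg : ∀ κ, 0 < κ → κ ^ 2 ≤ m ^ 2 - 1 → rτ ≠ regularRatio κ 0 (π / 2)) :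
    ∃ κ θ₁ θ₂ : ℝ, OptimalTwoSwitchings m rτ (π / 2) κ θ₁ θ₂ ∧ (θ₂ = π / 2 ↔ rτ = rD2 m) := by
  have hr1 := hr2.trans_lt (rD2_lt_rD1 hm)
  rw [← exp_neg_saturatedDecay_pi_div_two hm] at hr1
  obtain ⟨κ, hκ, rfl⟩ := exists_totalDecay_eq hm (Or.inl rfl) hr hr1
  have hκm : m ^ 2 - 1 < κ ^ 2 := by
    by_contra! hle
    exact hreg κ hκ hle (exp_neg_totalDecay_of_sq_le hm hκ hle (Or.inl rfl))
  obtain ⟨θ₁, θ₂, h⟩ := exists_switchingAngles hm hκ hκm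
  refine ⟨κ, θ₁, θ₂, h.optimalTwoSwitchings hm (Or.inl rfl) (not_lt.1 fun hlt => ?_), ?_⟩
  · exact hr2.not_gt ((exp_neg_totalDecay_lt_rD2_iff hm hκ).2 ((h.pi_div_two_lt_iff hm).1 hlt))
  · rw [h.second_eq_pi_div_two_iff hm, exp_neg_totalDecay_eq_rD2_iff hm hκ]

/-- Without saturation no law is a minimum-energy feedback if `m < 1`. -/
lemma not_isMinimumEnergyFeedback_regularLaw (hm : 1 / 2 < m) (hm1 : m < 1) (hr : 0 < rτ) {θτ : ℝ}
    (hτ : θτ = π / 2 ∨ θτ = π) (κ : ℝ) : ¬ IsMinimumEnergyFeedback m rτ θτ (regularLaw κ) := by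
  intro h
  have hτ0 := target_pos hτ
  rcases lt_trichotomy rτ (exp (-saturatedDecay m θτ)) with hlt | rfl | hgt
  · obtain ⟨κ₀, hκ₀, rfl⟩ := exists_totalDecay_eq hm hτ hr hlt
    obtain ⟨θ₁, θ₂, hθ⟩ := exists_switchingAngles (m := m) hm hκ₀ (by nlinarith)
    have hU := hθ.isMinimumEnergyFeedback hm hτ
    have hτπ : π / 2 ≤ θτ := by rcases hτ with rfl | rfl <;> linarith [pi_pos]
    have h1 := hθ.first_lt_pi_div_two hm
    obtain ⟨b, hb1, hb2⟩ := exists_between (lt_min (h1.trans_le hτπ) hθ.first_lt_second)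
    have hbτ : b < θτ := hb2.trans_le (min_le_left _ _)
    have hbθ : b < θ₂ := hb2.trans_le (min_le_right _ _)
    -- On `(θ₁, b)` the optimal control is `m`, so `regularLaw κ` would equal `m` somewhere in each
    -- subinterval. Three such points contradict a quadratic equation in `cot x`.
    have key : ∀ y₁ y₂, θ₁ ≤ y₁ → y₁ < y₂ → y₂ ≤ b → ∃ x ∈ Ioo y₁ y₂,
        (m * cot x - 1) ^ 2 = κ ^ 2 - m ^ 2 + 1 := by
      intro y₁ y₂ hy1 hy hy2
      obtain ⟨x, hx, hx'⟩ := hU.exists_eq h (hθ.first_pos.trans_le hy1) hy (hy2.trans_lt hbτ)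
      refine ⟨x, hx, ?_⟩
      have hs : 0 < sin x := sin_pos_of_pos_of_lt_pi
        ((hθ.first_pos.trans_le hy1).trans hx.1)
        ((hx.2.trans_le hy2).trans (hbθ.trans hθ.second_lt_pi))
      have hm' : regularLaw κ x - m = 0 := by
        rw [← hx', switchedLaw, if_pos ⟨hy1.trans_lt hx.1, (hx.2.trans_le hy2).trans hbθ⟩, sub_self]
      have := regularLaw_sub m κ hs.ne'
      rw [hm', zero_mul] at this
      have := (mul_eq_zero.1 this.symm).resolve_left (pow_pos hs 2).ne'
      linarith
    obtain ⟨c, hc1, hc2⟩ := exists_between hb1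
    obtain ⟨d, hd1, hd2⟩ := exists_between hc2
    obtain ⟨x, hx, ex⟩ := key θ₁ c le_rfl hc1 hc2.le
    obtain ⟨y, hy, ey⟩ := key c d hc1.le hd1 hd2.le
    obtain ⟨z, hz, ez⟩ := key d b (hc1.trans hd1).le hd2 le_rfl
    have hzπ : z < π := hz.2.trans (hbθ.trans hθ.second_lt_pi)
    have hxy : cot y < cot x := cot_lt_cot (hθ.first_pos.trans hx.1) (hx.2.trans hy.1)
      ((hy.2.trans hz.1).trans hzπ)
    have hyz : cot z < cot y := cot_lt_cot ((hθ.first_pos.trans hc1).trans hy.1) (hy.2.trans hz.1) hzπ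
    have hm0 : 0 < m := by linarith
    have e1 : m * cot x + m * cot y - 2 = 0 := by
      have : (m * cot x + m * cot y - 2) * (m * (cot x - cot y)) = 0 := by linarith
      exact (mul_eq_zero.1 this).resolve_right (mul_pos hm0 (sub_pos.2 hxy)).ne'
    have e2 : m * cot x + m * cot z - 2 = 0 := by
      have : (m * cot x + m * cot z - 2) * (m * (cot x - cot z)) = 0 := by linarith
      exact (mul_eq_zero.1 this).resolve_right (mul_pos hm0 (sub_pos.2 (hyz.trans hxy))).ne'
    nlinarith
  -- At the largest radius the control is `m` right from the pole, where `regularLaw κ` is still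
  -- below `m`.
  · obtain ⟨y, hy, hlt⟩ := exists_unsaturated hm hτ0 κ
    obtain ⟨x, hx, hx'⟩ := (isMinimumEnergyFeedback_saturatedLaw hm hτ).exists_eq h
      (y₁ := y / 3) (y₂ := y / 2) (by linarith [hy.1]) (by linarith [hy.1]) (by linarith [hy.1, hy.2])
    have hx0 : 0 < x := by linarith [hx.1, hy.1]
    have hxy : x < y := by linarith [hx.2, hy.1]
    rw [saturatedLaw, if_pos ⟨hx0, (hxy.trans hy.2).trans_le (target_le_pi hτ)⟩, regularLaw] at hx'
    linarith [hlt x ⟨hx0, hxy⟩]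
  · obtain ⟨I, u, a, θ, h1, -⟩ := h.exists_minimizer
    exact (saturated_bound hm hτ hr h1.transfer).1.not_gt hgt

end Conclusions

end BlochPulse

theorem mainTheorem1 (m rτ : ℝ) (hm : 1 / 2 < m) (hr : 0 < rτ) :
    -- the largest reachable radii
    (rC1 m < rτ → ¬ ∃ (I : Set ℝ) (u a θ : ℝ → ℝ), IsTransfer m rτ π I u a θ) ∧
    (rD1 m < rτ → ¬ ∃ (I : Set ℝ) (u a θ : ℝ → ℝ), IsTransfer m rτ (π / 2) I u a θ) ∧
    -- limiting cases: the switching angles are `0` and `π`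
    (rτ = rC1 m → IsMinimumEnergyFeedback m rτ π (saturatedLaw m)) ∧
    (rτ = rD1 m → IsMinimumEnergyFeedback m rτ (π / 2) (saturatedLaw m)) ∧
    (1 ≤ m →
      (rC2 m < rτ → rτ < rC1 m →
        ∃ κ θ₁ θ₂ : ℝ, OptimalTwoSwitchings m rτ π κ θ₁ θ₂) ∧
      (rτ ≤ rC2 m →
        IsMinimumEnergyFeedback m rτ π (regularLaw (2 * √rτ / (1 - rτ)))) ∧
      (rD2 m < rτ → rτ < rD1 m →
        ∃ κ θ₁ θ₂ : ℝ, OptimalOneSwitching m rτ (π / 2) κ θ₁ θ₂) ∧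
      (rD3 m < rτ → rτ ≤ rD2 m →
        ∃ κ θ₁ θ₂ : ℝ, OptimalTwoSwitchings m rτ (π / 2) κ θ₁ θ₂ ∧
          (θ₂ = π / 2 ↔ rτ = rD2 m)) ∧
      (rτ ≤ rD3 m →
        IsMinimumEnergyFeedback m rτ (π / 2) (regularLaw (2 * rτ / (1 - rτ ^ 2))))) ∧
    (m < 1 →
      (rτ < rC1 m →
        ∃ κ θ₁ θ₂ : ℝ, OptimalTwoSwitchings m rτ π κ θ₁ θ₂) ∧
      (rD2 m < rτ → rτ < rD1 m →
        ∃ κ θ₁ θ₂ : ℝ, OptimalOneSwitching m rτ (π / 2) κ θ₁ θ₂) ∧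
      (rτ ≤ rD2 m →
        ∃ κ θ₁ θ₂ : ℝ, OptimalTwoSwitchings m rτ (π / 2) κ θ₁ θ₂ ∧
          (θ₂ = π / 2 ↔ rτ = rD2 m)) ∧
      (∀ κ : ℝ, ¬ IsMinimumEnergyFeedback m rτ π (regularLaw κ)) ∧
      (∀ κ : ℝ, ¬ IsMinimumEnergyFeedback m rτ (π / 2) (regularLaw κ))) := by
  have hC1 := exp_neg_saturatedDecay_pi hm
  have hD1 := exp_neg_saturatedDecay_pi_div_two hm
  refine ⟨?_, ?_, ?_, ?_, fun hm1 => ⟨?_, ?_, ?_, ?_, ?_⟩, fun hm1 => ⟨?_, ?_, ?_, ?_, ?_⟩⟩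
  · rintro hlt ⟨I, u, a, θ, h⟩
    exact ((saturated_bound hm (Or.inr rfl) hr h).1.trans_eq hC1).not_gt hlt
  · rintro hlt ⟨I, u, a, θ, h⟩
    exact ((saturated_bound hm (Or.inl rfl) hr h).1.trans_eq hD1).not_gt hlt
  · rintro rfl
    rw [← hC1]
    exact isMinimumEnergyFeedback_saturatedLaw hm (Or.inr rfl)
  · rintro rfl
    rw [← hD1]
    exact isMinimumEnergyFeedback_saturatedLaw hm (Or.inl rfl)
  · exact fun h2 h1 => optimalTwoSwitchings_pi hm hr h1 fun κ _ hle he =>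
      (he.trans_le (regularRatio_pi_le hm hle)).not_gt h2
  · intro h
    have h1 := h.trans_lt (rC2_lt_one hm)
    have := isMinimumEnergyFeedback_regularLaw hm
      (div_pos (mul_pos two_pos (sqrt_pos.2 hr)) (sub_pos.2 h1)) (sq_le_of_le_rC2 hm hr h)
      (Or.inr rfl)
    rwa [regularRatio_pi_self hr h1] at this
  · exact optimalOneSwitching_pi_div_two hm hr
  · exact fun h3 h2 => optimalTwoSwitchings_pi_div_two hm hr h2 fun κ hκ hle he =>
      (he.trans_le (regularRatio_pi_div_two_le hm1 hκ hle)).not_gt h3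
  · intro h
    have h1 := lt_one_of_le_rD3 hm1 hr h
    have := isMinimumEnergyFeedback_regularLaw hm
      (div_pos (mul_pos two_pos hr) (by nlinarith : 0 < 1 - rτ ^ 2)) (sq_le_of_le_rD3 hm1 hr h)
      (Or.inl rfl)
    rwa [regularRatio_pi_div_two_self hr h1] at this
  -- For `m < 1` no `κ` satisfies `κ ^ 2 ≤ m ^ 2 - 1`.
  · exact fun h1 => optimalTwoSwitchings_pi hm hr h1 fun κ hκ hle => by nlinarith
  · exact optimalOneSwitching_pi_div_two hm hr
  · exact fun h2 => optimalTwoSwitchings_pi_div_two hm hr h2 fun κ hκ hle => by nlinarith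
  · exact not_isMinimumEnergyFeedback_regularLaw hm hm1 hr (Or.inr rfl)
  · exact not_isMinimumEnergyFeedback_regularLaw hm hm1 hr (Or.inl rfl)
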